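/- **Setting.** Let $(E,r)$ be a Polish space (a complete separable metric space), let $\mathbb D(E)$ be the space of càdlàg functions $\mathbb R_+\to E$ with the Skorokhod $J_1$ topology and its Borel $\sigma$-field, and let $C_b(E)$ be the set of bounded continuous functions $E\to\mathbb R$. Let $\mathbb B=(\Omega,\mathcal F,\mathbf F,P)$ and $\mathbb B^n=(\Omega^n,\mathcal F^n,\mathbf F^n,P^n)$, $n\in\mathbb N$, be filtered probability spaces which support $E$-valued càdlàg adapted processes $X$ and $X^n$, respectively, where $\mathbf F$ is the filtration generated by $X$. Let $D\subset C_b(E)\times C_b(E)$ and let $q,q^1,q^2,\dots$ be locally finite Borel measures on $\mathbb R_+$ (point masses are allowed). We write $\int_s^t=\int_{(s,t]}$. Let $\mathfrak X$ be the set of the processes $$f(X)-f(X_0)-\int_0^\cdot g(X_{s-})\,q(ds),\qquad (f,g)\in D.$$ For every $n$ let $\mathfrak X^n$ be a set of pairs $(\xi,\phi)$ of real-valued predictable processes on $\mathbb B^n$ such that $\sup_{s\le T}E^{P^n}[|\xi_s|+|\phi_s|]<\infty$ for all $T>0$ and such that $\xi-\int_0^\cdot\phi_s\,q^n(ds)$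 is a martingale on $\mathbb B^n$. Let $(U,\mathcal U)$ be a measurable space, let $\mathfrak u\colon U\times\mathbb R_+\to\mathbb R_+$ be $\mathcal U\otimes\mathcal B(\mathbb R_+)$-measurable with $$\lim_{\varepsilon\searrow0}\sup\{\mathfrak u(u,s)\colon s\neq t,\ t-\varepsilon\le s\le t+\varepsilon\}=0\qquad\text{for all } u\in U,\ t>0,$$ let $\kappa\colon\mathbb R_+\to\mathbb R_+$ be increasing (not necessarily strictly) and continuous, let $x_0\in E$, and put $$A=\Big\{(u,\omega)\in U\times\mathbb D(E)\colon r(\omega(t),\omega(t-))\le\mathfrak u(u,t)\,\kappa\Big(\sup_{s\le t}r(\omega(s),x_0)\Big)\text{ for all }t>0\Big\}.$$ Let $M_m(U)$ be the set of probability measures on $(U,\mathcal U)$ with the weakest topology for which $\mu\mapsto\int f\,d\mu$ is continuous for every bounded measurable $f\colon U\to\mathbb R$. **Theorem.** Suppose that $X^n\to X$ weakly in $\mathbb D(E)$ with the Skorokhod $J_1$ topology, and that the following two conditions hold. 1. (Control variables.) Each $\mathbb B^n$ supports a $U$-valued random variable $L^n$ such that $P^n((L^n,X^n)\in A)\to1$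 as $n\to\infty$, and one of the following holds: (a) the law $P^n\circ(L^n)^{-1}$ does not depend on $n$; (b) $\mathcal U$ is countably generated and $\{P^n\circ(L^n)^{-1}\colon n\in\mathbb N\}$ is relatively compact in $M_m(U)$. 2. (Approximation.) There is a dense set $\Gamma\subset\mathbb R_+$ such that for each $(f,g)\in D$ and $T>0$ there is a sequence $(\xi^n,\phi^n)\in\mathfrak X^n$, $n\in\mathbb N$, with $$\sup_{n\in\mathbb N}\sup_{s\le T}E^{P^n}\big[|\xi^n_s|+|\phi^n_s|\big]<\infty$$ and $$\lim_{n\to\infty}E^{P^n}\Big[(\xi^n_t-f(X^n_t))\prod_{i=1}^kh_i(X^n_{t_i})\Big]=0,$$ $$\lim_{n\to\infty}E^{P^n}\Big[\int_s^t(\phi^n_v-g(X^n_{v-}))\,q(dv)\prod_{i=1}^kh_i(X^n_{t_i})\Big]=0,$$ $$\lim_{n\to\infty}E^{P^n}\Big[\Big(\int_s^t\phi^n_v\,q^n(dv)-\int_s^t\phi^n_v\,q(dv)\Big)\prod_{i=1}^kh_i(X^n_{t_i})\Big]=0$$ for all $s,t\in\Gamma\cap[0,T]$ with $s<t$, all $k\in\mathbb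 N$, $t_1,\dots,t_k\in\Gamma\cap[0,t]$ and $h_1,\dots,h_k\in C_b(E)$. Then $P$ solves the martingale problem $\mathfrak X$, that is, every process in $\mathfrak X$ is an $(\mathbf F,P)$-martingale. -/

import Mathlib

open Filter Topology MeasureTheory ProbabilityTheory Set
open scoped NNReal ENNReal BoundedContinuousFunction

/-- A path `ω : ℝ₊ → E` is càdlàg if it is right-continuous with left limits (at `t = 0` the
left-limit requirement is void). -/
def IsCadlag {E : Type*} [TopologicalSpace E] (ω : ℝ≥0 → E) : Prop :=
  ∀ t : ℝ≥0, ContinuousWithinAt ω (Ici t) t ∧ ∃ l : E, Tendsto ω (𝓝[<] t) (𝓝 l)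

/-- The space `𝔻(E)` of càdlàg paths `ℝ₊ → E`. -/
@[ext]
structure SkorokhodSpace (E : Type*) [TopologicalSpace E] where
  toFun : ℝ≥0 → E
  isCadlag : IsCadlag toFun

namespace SkorokhodSpace

instance {E : Type*} [TopologicalSpace E] : CoeFun (SkorokhodSpace E) (fun _ => ℝ≥0 → E) :=
  ⟨SkorokhodSpace.toFun⟩

/-- The basic `J₁`-neighbourhood of `ω`: the paths `η` that are `ε`-close to `ω` on `[0, T]` after
a time change `lam` (an increasing bijection of `ℝ₊`, automatically a homeomorphism fixing `0`)
which is itself `ε`-close to the identity on `[0, T]`. -/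
def basicNhd {E : Type*} [MetricSpace E] (ω : SkorokhodSpace E) (T : ℝ≥0) (ε : ℝ) :
    Set (SkorokhodSpace E) :=
  {η | ∃ lam : ℝ≥0 ≃o ℝ≥0, ∀ s ≤ T, dist (lam s) s < ε ∧ dist (η (lam s)) (ω s) < ε}

theorem basicNhd_mono {E : Type*} [MetricSpace E] (ω : SkorokhodSpace E) {T T' : ℝ≥0}
    {ε ε' : ℝ} (hT : T ≤ T') (hε : ε' ≤ ε) : basicNhd ω T' ε' ⊆ basicNhd ω T ε := by
  rintro η ⟨lam, h⟩
  exact ⟨lam, fun s hs => ⟨(h s (hs.trans hT)).1.trans_le hε, (h s (hs.trans hT)).2.trans_le hε⟩⟩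

/-- The Skorokhod `J₁` topology: a set is open if with each of its points `ω` it contains a basic
neighbourhood of `ω`. Equivalently, `ω_n → ω` if and only if for each `T` there are increasing
bijections `lam_n` of `ℝ₊` such that `sup_{s ≤ T} |lam_n s - s| → 0` and
`sup_{s ≤ T} r (ω_n (lam_n s), ω s) → 0`. -/
instance instTopologicalSpace {E : Type*} [MetricSpace E] :
    TopologicalSpace (SkorokhodSpace E) where
  IsOpen O := ∀ ω ∈ O, ∃ T : ℝ≥0, ∃ ε : ℝ, 0 < ε ∧ basicNhd ω T ε ⊆ O
  isOpen_univ := fun _ _ => ⟨0, 1, one_pos, subset_univ _⟩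
  isOpen_inter := by
    rintro O O' h h' ω ⟨hω, hω'⟩
    obtain ⟨T, ε, hε, hO⟩ := h ω hω
    obtain ⟨T', ε', hε', hO'⟩ := h' ω hω'
    exact ⟨max T T', min ε ε', lt_min hε hε', subset_inter
      ((basicNhd_mono ω (le_max_left _ _) (min_le_left _ _)).trans hO)
      ((basicNhd_mono ω (le_max_right _ _) (min_le_right _ _)).trans hO')⟩
  isOpen_sUnion := by
    rintro 𝒪 h ω ⟨O, hO, hω⟩
    obtain ⟨T, ε, hε, hsub⟩ := h O hO ω hω
    exact ⟨T, ε, hε, hsub.trans (subset_sUnion_of_mem hO)⟩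

/-- `𝔻(E)` carries the Borel `σ`-field of the `J₁` topology. -/
instance instMeasurableSpace {E : Type*} [MetricSpace E] : MeasurableSpace (SkorokhodSpace E) :=
  borel _

instance instBorelSpace {E : Type*} [MetricSpace E] : BorelSpace (SkorokhodSpace E) :=
  ⟨rfl⟩

end SkorokhodSpace

/-- The `𝔻(E)`-valued map `ω ↦ (t ↦ X_t(ω))` of a process with càdlàg paths. -/
def pathMap {Ω E : Type*} [TopologicalSpace E] (X : ℝ≥0 → Ω → E)
    (hX : ∀ ω, IsCadlag (fun t => X t ω)) (ω : Ω) : SkorokhodSpace E :=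
  ⟨fun t => X t ω, hX ω⟩

/-- The set `A ⊆ U × 𝔻(E)` of pairs `(u, ω)` with
`r (ω(t), ω(t-)) ≤ 𝔲(u, t) κ(sup_{s ≤ t} r(ω(s), x₀))` for all `t > 0`. (The supremum is a genuine
one, because càdlàg paths are bounded on compact time intervals.) -/
def jumpControlSet {U E : Type*} [MetricSpace E] (𝔲 : U → ℝ≥0 → ℝ≥0) (κ : ℝ≥0 → ℝ≥0) (x₀ : E) :
    Set (U × SkorokhodSpace E) :=
  {p | ∀ t : ℝ≥0, 0 < t → nndist (p.2 t) (Function.leftLim p.2.toFun t) ≤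
    𝔲 p.1 t * κ (⨆ s : Iic t, nndist (p.2 s) x₀)}

/-- The topology of `M_m(U)`: the weakest topology on the probability measures on `U` for which
`μ ↦ ∫ f dμ` is continuous for every bounded measurable `f : U → ℝ`. -/
@[reducible]
noncomputable def boundedMeasurableTopology (U : Type*) [MeasurableSpace U] :
    TopologicalSpace (ProbabilityMeasure U) :=
  ⨅ f : {f : U → ℝ // Measurable f ∧ ∃ C : ℝ, ∀ u, |f u| ≤ C},
    TopologicalSpace.induced (fun μ : ProbabilityMeasure U => ∫ u, f.1 u ∂(μ : Measure U))
      inferInstance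

/-- Relative compactness in `M_m(U)`: the closure is compact. -/
def IsRelativelyCompactInMm {U : Type*} [MeasurableSpace U] (S : Set (ProbabilityMeasure U)) :
    Prop :=
  @IsCompact _ (boundedMeasurableTopology U) (@closure _ (boundedMeasurableTopology U) S)

/-- The test process `f(X_t) - f(X_0) - ∫_{(0,t]} g(X_{s-}) q(ds)`. -/
noncomputable def testProcess {Ω E : Type*} [TopologicalSpace E] (X : ℝ≥0 → Ω → E)
    (q : Measure ℝ≥0) (f g : E → ℝ) : ℝ≥0 → Ω → ℝ :=
  fun t ω => f (X t ω) - f (X 0 ω) -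
    ∫ s in Ioc 0 t, g (Function.leftLim (fun v => X v ω) s) ∂q

/-- The set `𝔛` of the test processes with `(f, g) ∈ D`. -/
def testProcesses {Ω E : Type*} [TopologicalSpace E] (X : ℝ≥0 → Ω → E) (q : Measure ℝ≥0)
    (D : Set ((E →ᵇ ℝ) × (E →ᵇ ℝ))) : Set (ℝ≥0 → Ω → ℝ) :=
  {Y | ∃ p ∈ D, Y = testProcess X q p.1 p.2}

/-- `P ∈ ℳ(𝔛)`: all processes in `𝔛` are `(𝓕, P)`-martingales. -/
def SolvesMartingaleProblem {Ω : Type*} {mΩ : MeasurableSpace Ω} (𝓕 : Filtration ℝ≥0 mΩ)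
    (P : Measure Ω) (𝔛 : Set (ℝ≥0 → Ω → ℝ)) : Prop :=
  ∀ Y ∈ 𝔛, Martingale Y 𝓕 P

/-- The pairs `(ξ, φ)` of which the sets `𝔛ⁿ` consist: real-valued predictable processes, bounded
in `L¹` on compact time intervals, such that `ξ - ∫_{(0,·]} φ_s q(ds)` is a martingale. -/
structure IsApproximatingPair {Ω : Type*} {mΩ : MeasurableSpace Ω} (𝓕 : Filtration ℝ≥0 mΩ)
    (P : Measure Ω) (q : Measure ℝ≥0) (ξ φ : ℝ≥0 → Ω → ℝ) : Prop where
  predictable_fst : IsStronglyPredictable 𝓕 ξ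
  predictable_snd : IsStronglyPredictable 𝓕 φ
  bounded : ∀ T : ℝ≥0, 0 < T → (⨆ s ≤ T, ∫⁻ ω, (‖ξ s ω‖ₑ + ‖φ s ω‖ₑ) ∂P) < ∞
  martingale : Martingale (fun t ω => ξ t ω - ∫ s in Ioc 0 t, φ s ω ∂q) 𝓕 P

/-! The obstacle is that `J₁` convergence says little about values at a fixed discontinuity time `t`
of `X`: the matching jump of `Xⁿ` may sit at a time close to `t` but different from it. Such times
cannot be avoided, because `q` may charge them and the limit equation evaluates `g` at left limits
there.

The control variables remove the obstacle. With high probability the running supremum of `Xⁿ` up to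
time `t + 1` is at most some `K`, so a jump larger than `a` at a time `s ≠ t` near `t` forces `a < 𝔲
(Lⁿ) s * κ K`. For each value of the control variable this excludes `s` close to `t`. Conditioning
on `Lⁿ` and using that the laws of `Lⁿ` are uniformly continuous from above at the empty set makes
the exclusion uniform in `n` (`exists_eventually_measure_jump_le`).

A path that is `J₁`-close to a given path either jumps by more than `a` near `t` but off `t`, or
oscillates little on each side of `t` (`exists_smallOsc_union_jumpNear_mem_nhds`). The first
alternative is now improbable, so one-sided oscillations of `Xⁿ` at `t` are small uniformly in large
`n`. One-sided averages over short time windows are continuous functionals on the path space, and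
they differ little from the value or the left limit at `t`. Hence the joint laws of values and left
limits at arbitrary positive times converge (`tendsto_integral_sideValue`).

For the approximating pairs, the martingale identity tested against a product of functions of the
past differs from the identity for `f`, `g` and `q` by four errors that vanish by hypothesis. The
terms in `f` converge by the preceding result; the drift does so by Fubini and dominated convergence
in `v`, since convergence holds at every `v > 0` and atoms of `q` do no harm. Right-continuity
extends the resulting orthogonality from positive times in `Γ` to all times. Products of bounded
continuous functions of finitely many coordinates determine integrals over the events of the natural
filtration, and this gives the martingale property. -/

theorem NNReal.exists_nnrat_btwn {a b : ℝ≥0} (h : a < b) :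
    ∃ q : ℚ≥0, a < (q : ℝ≥0) ∧ (q : ℝ≥0) < b := by
  obtain ⟨r, h0, h1, h2⟩ := (NNReal.lt_iff_exists_rat_btwn a b).1 h
  have hr : ((r.toNNRat : ℚ≥0) : ℝ≥0) = Real.toNNReal r := by
    apply NNReal.coe_injective
    rw [Real.coe_toNNReal _ (by exact_mod_cast h0)]
    have : ((r.toNNRat : ℚ) : ℝ) = r := by rw [Rat.coe_toNNRat r h0]
    rw [← this, NNRat.cast_def, Rat.cast_def, NNRat.num_coe, NNRat.den_coe]
    simp
  exact ⟨r.toNNRat, by rwa [hr], by rwa [hr]⟩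

/-! ### The `J₁` uniformity and pseudometrizability -/

namespace SkorokhodSpace

variable {E : Type*} [MetricSpace E]

theorem mem_basicNhd_self (ω : SkorokhodSpace E) (T : ℝ≥0) {ε : ℝ} (hε : 0 < ε) :
    ω ∈ basicNhd ω T ε :=
  ⟨OrderIso.refl _, fun s _ => by simpa using hε⟩

/-- Inverting the time change works on a shorter horizon: as `lam` moves `T + 1` by less than `1`,
the preimage of `[0, T]` stays inside `[0, T + 1]`. -/
theorem mem_basicNhd_symm {ω η : SkorokhodSpace E} {T : ℝ≥0} {ε : ℝ} (hε : ε ≤ 1)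
    (h : η ∈ basicNhd ω (T + 1) ε) : ω ∈ basicNhd η T ε := by
  obtain ⟨lam, h⟩ := h
  refine ⟨lam.symm, fun s hs => ?_⟩
  have hT : lam.symm s ≤ T + 1 := by
    rw [OrderIso.symm_apply_le]
    have h1 := (h (T + 1) le_rfl).1
    rw [NNReal.dist_eq, abs_lt] at h1
    refine hs.trans ?_
    rw [← NNReal.coe_le_coe]
    push_cast at h1
    linarith [h1.1]
  have h2 := h _ hT
  rw [OrderIso.apply_symm_apply, dist_comm s, dist_comm (η s)] at h2
  exact h2

theorem mem_basicNhd_trans {ω η ζ : SkorokhodSpace E} {T : ℝ≥0} {ε ε' : ℝ} (hε : ε ≤ 1)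
    (h : η ∈ basicNhd ω T ε) (h' : ζ ∈ basicNhd η (T + 1) ε') :
    ζ ∈ basicNhd ω T (ε + ε') := by
  obtain ⟨lam, h⟩ := h
  obtain ⟨lam', h'⟩ := h'
  refine ⟨lam.trans lam', fun s hs => ?_⟩
  have h1 := h s hs
  have hT : lam s ≤ T + 1 := by
    have h2 := h1.1
    rw [NNReal.dist_eq, abs_lt] at h2
    rw [← NNReal.coe_le_coe] at hs ⊢
    push_cast
    linarith [h2.2]
  have h2 := h' _ hT
  rw [OrderIso.trans_apply]
  exact ⟨(dist_triangle _ (lam s) _).trans_lt (by linarith [h1.1, h2.1]),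
    (dist_triangle _ (η (lam s)) _).trans_lt (by linarith [h1.2, h2.2])⟩

/-- The entourages `{(ω, η) | η ∈ basicNhd ω n (1 / (n + 1))}` of the `J₁` uniformity. -/
def entourage (E : Type*) [MetricSpace E] (n : ℕ) : Set (SkorokhodSpace E × SkorokhodSpace E) :=
  {p | p.2 ∈ basicNhd p.1 n (1 / (n + 1))}

theorem entourage_antitone : Antitone (entourage E) := by
  intro m n hmn p hp
  refine basicNhd_mono p.1 (by exact_mod_cast hmn) ?_ hp
  exact one_div_le_one_div_of_le (by positivity) (by gcongr)

theorem hasBasis_iInf_entourage :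
    (⨅ n, 𝓟 (entourage E n)).HasBasis (fun _ : ℕ => True) (entourage E) := by
  refine hasBasis_iInf_principal (directed_of_isDirected_le ?_)
  exact fun m n h => entourage_antitone h

theorem exists_entourage_subset (ω : SkorokhodSpace E) (T : ℝ≥0) {ε : ℝ} (hε : 0 < ε) :
    ∃ n : ℕ, Prod.mk ω ⁻¹' entourage E n ⊆ basicNhd ω T ε := by
  obtain ⟨n, hn⟩ := exists_nat_one_div_lt hε
  obtain ⟨m, hm⟩ := exists_nat_ge T
  refine ⟨max n m, basicNhd_mono ω (hm.trans (by simp)) (le_trans ?_ hn.le)⟩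
  exact one_div_le_one_div_of_le (by positivity) (by simp)

/-- The uniformity of `J₁` convergence. -/
def uniformCore (E : Type*) [MetricSpace E] : UniformSpace.Core (SkorokhodSpace E) :=
  .mk' (⨅ n, 𝓟 (entourage E n))
    (by
      intro r hr ω
      obtain ⟨n, -, hn⟩ := hasBasis_iInf_entourage.mem_iff.1 hr
      exact hn (mem_basicNhd_self ω _ (by positivity)))
    (by
      intro r hr
      obtain ⟨n, -, hn⟩ := hasBasis_iInf_entourage.mem_iff.1 hr
      refine hasBasis_iInf_entourage.mem_iff.2 ⟨n + 1, trivial, fun p hp => hn ?_⟩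
      have h1 : (1 : ℝ) / ((n + 1 : ℕ) + 1) ≤ 1 / (n + 1) :=
        one_div_le_one_div_of_le (by positivity) (by push_cast; linarith)
      have h2 : (1 : ℝ) / (n + 1) ≤ 1 := by
        rw [div_le_one (by positivity)]; linarith [(Nat.cast_nonneg n : (0 : ℝ) ≤ n)]
      have h3 : p.2 ∈ basicNhd p.1 (n + 1) (1 / (n + 1)) :=
        basicNhd_mono p.1 (by push_cast; exact le_rfl) h1 hp
      exact mem_basicNhd_symm h2 h3)
    (by
      intro r hr
      obtain ⟨n, -, hn⟩ := hasBasis_iInf_entourage.mem_iff.1 hr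
      refine ⟨entourage E (2 * n + 1), hasBasis_iInf_entourage.mem_of_mem trivial, ?_⟩
      rintro ⟨ω, ζ⟩ ⟨η, h1, h2⟩
      refine hn ?_
      have h3 : (1 : ℝ) / ((2 * n + 1 : ℕ) + 1) ≤ 1 := by
        rw [div_le_one (by positivity)]; push_cast; linarith [(Nat.cast_nonneg n : (0 : ℝ) ≤ n)]
      have h4 : (1 : ℝ) / ((2 * n + 1 : ℕ) + 1) + 1 / ((2 * n + 1 : ℕ) + 1) = 1 / (n + 1) := by
        push_cast; field_simp; ring
      have h5 : η ∈ basicNhd ω n (1 / ((2 * n + 1 : ℕ) + 1)) :=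
        basicNhd_mono ω (by exact_mod_cast (by lia : n ≤ 2 * n + 1)) le_rfl h1
      have h6 : ζ ∈ basicNhd η (n + 1) (1 / ((2 * n + 1 : ℕ) + 1)) :=
        basicNhd_mono η (by exact_mod_cast (by lia : n + 1 ≤ 2 * n + 1)) le_rfl h2
      have h7 := mem_basicNhd_trans h3 h5 h6
      rw [h4] at h7
      exact h7)

theorem instTopologicalSpace_eq :
    (instTopologicalSpace : TopologicalSpace (SkorokhodSpace E)) =
      (uniformCore E).toTopologicalSpace := by
  ext O
  change (∀ ω ∈ O, ∃ T : ℝ≥0, ∃ ε : ℝ, 0 < ε ∧ basicNhd ω T ε ⊆ O) ↔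
    ∀ ω ∈ O, O ∈ comap (Prod.mk ω) (⨅ n, 𝓟 (entourage E n))
  refine forall₂_congr fun ω _ => ?_
  rw [(hasBasis_iInf_entourage.comap (Prod.mk ω)).mem_iff]
  constructor
  · rintro ⟨T, ε, hε, h⟩
    obtain ⟨n, hn⟩ := exists_entourage_subset ω T hε
    exact ⟨n, trivial, hn.trans h⟩
  · rintro ⟨n, -, h⟩
    exact ⟨n, 1 / (n + 1), by positivity, h⟩

/-- The uniform structure inducing the `J₁` topology. -/
@[reducible]
def uniformSpace (E : Type*) [MetricSpace E] : UniformSpace (SkorokhodSpace E) :=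
  .ofCoreEq (uniformCore E) instTopologicalSpace instTopologicalSpace_eq

/-- The uniformity has a countable basis. Pseudometrizability is what the portmanteau inequality for
closed sets and dominated convergence along neighbourhood filters of paths rely on. -/
instance : TopologicalSpace.PseudoMetrizableSpace (SkorokhodSpace E) := by
  let := uniformSpace E
  have : (uniformity (SkorokhodSpace E)).IsCountablyGenerated :=
    HasBasis.isCountablyGenerated (hasBasis_iInf_entourage (E := E))
  exact UniformSpace.pseudoMetrizableSpace

/-- Not immediate from the definition of the topology, because a basic neighbourhood need not be
open; the approximate triangle inequality encoded in the uniformity is needed. -/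
theorem basicNhd_mem_nhds (ω : SkorokhodSpace E) (T : ℝ≥0) {ε : ℝ} (hε : 0 < ε) :
    basicNhd ω T ε ∈ 𝓝 ω := by
  let := uniformSpace E
  obtain ⟨n, hn⟩ := exists_entourage_subset ω T hε
  rw [nhds_eq_comap_uniformity]
  exact mem_of_superset (preimage_mem_comap (hasBasis_iInf_entourage.mem_of_mem trivial)) hn

end SkorokhodSpace

/-! ### Càdlàg paths: local boundedness and exhaustion of the jump times -/

namespace IsCadlag

variable {E : Type*} [MetricSpace E] {ω : ℝ≥0 → E}

theorem tendsto_leftLim (h : IsCadlag ω) (t : ℝ≥0) :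
    Tendsto ω (𝓝[<] t) (𝓝 (Function.leftLim ω t)) :=
  tendsto_leftLim_of_tendsto (h t).2

/-- By the convention for `Function.leftLim` where there is nothing to the left, no path jumps at
time `0`. -/
theorem leftLim_zero (ω : ℝ≥0 → E) : Function.leftLim ω 0 = ω 0 :=
  leftLim_eq_of_isBot isBot_bot

theorem continuousAt (h : IsCadlag ω) {t : ℝ≥0} (ht : Function.leftLim ω t = ω t) :
    ContinuousAt ω t := by
  have h1 := h.tendsto_leftLim t
  rw [ht] at h1
  rw [ContinuousAt, ← nhdsLT_sup_nhdsGE]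
  exact h1.sup (h t).1

theorem bddAbove_nndist (h : IsCadlag ω) (x : E) (T : ℝ≥0) :
    ∃ K : ℝ≥0, ∀ s ≤ T, nndist (ω s) x ≤ K := by
  have key : ∃ K : ℝ≥0, ∀ s ∈ Icc 0 T, nndist (ω s) x ≤ K := by
    refine isCompact_Icc.induction_on (p := fun S => ∃ K : ℝ≥0, ∀ s ∈ S, nndist (ω s) x ≤ K)
      ⟨0, by simp⟩ ?_ ?_ ?_
    · rintro S S' hS ⟨K, hK⟩
      exact ⟨K, fun s hs => hK s (hS hs)⟩
    · rintro S S' ⟨K, hK⟩ ⟨K', hK'⟩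
      refine ⟨max K K', fun s hs => ?_⟩
      rcases hs with hs | hs
      · exact (hK s hs).trans (le_max_left _ _)
      · exact (hK' s hs).trans (le_max_right _ _)
    · intro t _
      have aux : ∀ {l : E} {f : Filter ℝ≥0}, Tendsto ω f (𝓝 l) →
          ∀ᶠ s in f, nndist (ω s) x ≤ nndist l x + 1 := fun hl =>
        (hl.nndist tendsto_const_nhds).eventually_le_const (lt_add_one _)
      have h1 := aux (h.tendsto_leftLim t)
      have h2 := aux (h t).1
      refine ⟨_, mem_nhdsWithin_of_mem_nhds (s := {s | nndist (ω s) x ≤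
        max (nndist (Function.leftLim ω t) x + 1) (nndist (ω t) x + 1)}) ?_, _, fun s hs => hs⟩
      rw [← nhdsLT_sup_nhdsGE]
      exact ⟨h1.mono fun s hs => hs.trans (le_max_left _ _),
        h2.mono fun s hs => hs.trans (le_max_right _ _)⟩
  obtain ⟨K, hK⟩ := key
  exact ⟨K, fun s hs => hK s ⟨zero_le, hs⟩⟩

theorem bddAbove_range (h : IsCadlag ω) (x : E) (T : ℝ≥0) :
    BddAbove (range fun s : Iic T => nndist (ω s) x) := by
  obtain ⟨K, hK⟩ := h.bddAbove_nndist x T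
  exact ⟨K, by rintro _ ⟨s, rfl⟩; exact hK s s.2⟩

end IsCadlag

/-- The first time after `p` at which the distance of `ω` to `ω p` exceeds `c`. -/
noncomputable def exitTime {E : Type*} [MetricSpace E] (p c : ℝ≥0) (ω : ℝ≥0 → E) : ℝ≥0 :=
  sInf {v | p < v ∧ c < nndist (ω v) (ω p)}

namespace IsCadlag

variable {E : Type*} [MetricSpace E] {ω : ℝ≥0 → E}

/-- Let `d` be the jump size. On `[p, t)` with `p` rational and close to `t`, the path stays within
`d / 8` of its left limit, hence within `d / 4` of `ω p`; at `t` its distance to `ω p` exceeds `7 *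
d / 8`. A rational level `c` between `d / 3` and `d / 2` separates the two, so it is first exceeded
exactly at `t`. -/
theorem exists_exitTime_eq (h : IsCadlag ω) {t : ℝ≥0} (ht : Function.leftLim ω t ≠ ω t) :
    ∃ p c : ℚ≥0, exitTime (p : ℝ≥0) (c : ℝ≥0) ω = t := by
  set x := Function.leftLim ω t with hx
  set d : ℝ := dist (ω t) x with hd
  have hdpos : 0 < d := dist_pos.2 ht.symm
  have ht0 : 0 < t := by
    rw [pos_iff_ne_zero]
    rintro rfl
    exact ht (leftLim_zero ω)
  have h1 : ∀ᶠ s in 𝓝[<] t, dist (ω s) x < d / 8 :=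
    (h.tendsto_leftLim t).eventually (Metric.ball_mem_nhds x (by linarith))
  obtain ⟨l, hl, hlt⟩ := (mem_nhdsLT_iff_exists_Ioo_subset' ht0).1 h1
  obtain ⟨p, hlp, hpt⟩ : ∃ p : ℚ≥0, l < (p : ℝ≥0) ∧ (p : ℝ≥0) < t := by
    exact NNReal.exists_nnrat_btwn hl
  obtain ⟨c, hc1, hc2⟩ : ∃ c : ℚ≥0, d / 3 < ((c : ℝ≥0) : ℝ) ∧ ((c : ℝ≥0) : ℝ) < d / 2 := by
    have h3 : Real.toNNReal (d / 3) < Real.toNNReal (d / 2) := by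
      rw [Real.toNNReal_lt_toNNReal_iff (by linarith)]; linarith
    obtain ⟨c, h1, h2⟩ := NNReal.exists_nnrat_btwn h3
    rw [← NNReal.coe_lt_coe, Real.coe_toNNReal _ (by linarith)] at h1 h2
    exact ⟨c, h1, h2⟩
  refine ⟨p, c, ?_⟩
  have hmem : ∀ s, (p : ℝ≥0) ≤ s → s < t → dist (ω s) x < d / 8 := fun s hps hst =>
    hlt ⟨hlp.trans_le hps, hst⟩
  have hp := hmem p le_rfl hpt
  have hin : t ∈ {v | (p : ℝ≥0) < v ∧ (c : ℝ≥0) < nndist (ω v) (ω p)} := by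
    refine ⟨hpt, ?_⟩
    rw [← NNReal.coe_lt_coe, coe_nndist]
    have := dist_triangle_right (ω t) x (ω p)
    have h3 := dist_triangle (ω t) (ω p) x
    linarith
  refine le_antisymm (csInf_le (OrderBot.bddBelow _) hin) (le_csInf ⟨t, hin⟩ ?_)
  rintro v ⟨hpv, hcv⟩
  by_contra! hvt
  have hv := hmem v hpv.le hvt
  rw [← NNReal.coe_lt_coe, coe_nndist] at hcv
  have := dist_triangle_right (ω v) (ω p) x
  linarith

theorem countable_jumps (h : IsCadlag ω) : {t | Function.leftLim ω t ≠ ω t}.Countable := by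
  refine (countable_range fun pc : ℚ≥0 × ℚ≥0 => exitTime (pc.1 : ℝ≥0) (pc.2 : ℝ≥0) ω).mono ?_
  intro t ht
  obtain ⟨p, c, hpc⟩ := h.exists_exitTime_eq ht
  exact ⟨(p, c), hpc⟩

end IsCadlag

/-! ### Joint measurability and measurable selection of jump times -/

/-- The first point of the grid `(n + 1)⁻¹ ℕ` that is strictly larger than `t`. -/
noncomputable def nextGridPoint (n : ℕ) (t : ℝ≥0) : ℝ≥0 :=
  ((⌊((n : ℝ≥0) + 1) * t⌋₊ : ℝ≥0) + 1) / ((n : ℝ≥0) + 1)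

theorem tendsto_nextGridPoint (t : ℝ≥0) :
    Tendsto (fun n => nextGridPoint n t) atTop (𝓝[>] t) := by
  refine tendsto_nhdsWithin_iff.2 ⟨?_, Eventually.of_forall fun n => ?_⟩
  · have h1 : Tendsto (fun n : ℕ => t + 1 / ((n : ℝ≥0) + 1)) atTop (𝓝 t) := by
      simpa using (tendsto_const_nhds (x := t)).add
        (tendsto_one_div_add_atTop_nhds_zero_nat (𝕜 := ℝ≥0))
    refine tendsto_of_tendsto_of_tendsto_of_le_of_le tendsto_const_nhds h1 ?_ ?_ <;> intro n
    · unfold nextGridPoint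
      beta_reduce
      rw [le_div_iff₀ (by positivity), mul_comm]
      exact (Nat.lt_floor_add_one _).le
    · unfold nextGridPoint
      beta_reduce
      rw [div_le_iff₀ (by positivity), add_mul t, div_mul_cancel₀ _ (by positivity), mul_comm t]
      gcongr
      exact Nat.floor_le zero_le
  · rw [nextGridPoint, mem_Ioi]
    rw [lt_div_iff₀ (by positivity), mul_comm]
    exact Nat.lt_floor_add_one _

theorem tendsto_natCast_div_add_one_mul {t : ℝ≥0} (ht : 0 < t) :
    Tendsto (fun n : ℕ => (n : ℝ≥0) / ((n : ℝ≥0) + 1) * t) atTop (𝓝[<] t) := by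
  refine tendsto_nhdsWithin_iff.2 ⟨?_, Eventually.of_forall fun n => ?_⟩
  · have h1 : Tendsto (fun n : ℕ => (n : ℝ≥0) / ((n : ℝ≥0) + 1)) atTop (𝓝 1) := by
      have := tendsto_natCast_div_add_atTop (1 : ℝ)
      rw [← NNReal.tendsto_coe]
      simpa using this
    simpa using h1.mul_const t
  · change _ / _ * t < t
    refine mul_lt_of_lt_one_left ht ?_
    rw [div_lt_one (by positivity)]
    exact lt_add_one _

namespace IsCadlag

variable {E : Type*} [MetricSpace E] {ω : ℝ≥0 → E}

theorem tendsto_right (h : IsCadlag ω) (t : ℝ≥0) : Tendsto ω (𝓝[>] t) (𝓝 (ω t)) :=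
  (h t).1.mono_left (nhdsWithin_mono t Ioi_subset_Ici_self)

theorem tendsto_mul_leftLim (h : IsCadlag ω) (t : ℝ≥0) :
    Tendsto (fun n : ℕ => ω ((n : ℝ≥0) / ((n : ℝ≥0) + 1) * t)) atTop
      (𝓝 (Function.leftLim ω t)) := by
  rcases eq_or_ne t 0 with rfl | ht
  · simp [leftLim_zero]
  · exact (h.tendsto_leftLim t).comp (tendsto_natCast_div_add_one_mul (pos_iff_ne_zero.2 ht))

/-- Right-continuity lets countably many times detect the supremum. Using fractions `c * t` rather
than fixed rational times keeps the description jointly measurable in `t`, and `c = 1` covers a jump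
at the right endpoint. -/
theorem lt_iSup_nndist_iff (h : IsCadlag ω) (x : E) (t b : ℝ≥0) :
    b < ⨆ s : Iic t, nndist (ω s) x ↔
      ∃ c : ℚ≥0, c ≤ 1 ∧ b < nndist (ω ((c : ℝ≥0) * t)) x := by
  constructor
  · intro hb
    obtain ⟨⟨s, hs⟩, hsb⟩ := exists_lt_of_lt_ciSup hb
    rcases eq_or_lt_of_le (show s ≤ t from hs) with rfl | hst
    · exact ⟨1, le_rfl, by simpa using hsb⟩
    · have ht : 0 < t := zero_le.trans_lt hst
      have h1 : ∀ᶠ v in 𝓝[>] s, b < nndist (ω v) x :=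
        ((h.tendsto_right s).nndist tendsto_const_nhds).eventually (lt_mem_nhds hsb)
      obtain ⟨r, hr, hsr⟩ := (mem_nhdsGT_iff_exists_Ioo_subset' hst).1 h1
      obtain ⟨c, hc1, hc2⟩ := NNReal.exists_nnrat_btwn
        (div_lt_div_of_pos_right (lt_min hr hst : s < min r t) ht)
      rw [div_lt_iff₀ ht] at hc1
      rw [lt_div_iff₀ ht, lt_min_iff] at hc2
      refine ⟨c, ?_, hsr ⟨hc1, hc2.1⟩⟩
      have hc : (c : ℝ≥0) < 1 := lt_of_mul_lt_mul_right (by simpa using hc2.2) t.2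
      exact_mod_cast hc.le
  · rintro ⟨c, hc, hcb⟩
    have hc' : (c : ℝ≥0) ≤ 1 := by exact_mod_cast hc
    exact hcb.trans_le (le_ciSup (h.bddAbove_range x t) (⟨c * t, mul_le_of_le_one_left t.2 hc'⟩ : Iic t))

end IsCadlag

section Measurability

variable {E : Type*} [MetricSpace E] [MeasurableSpace E] [BorelSpace E]
  {Ω : Type*} {mΩ : MeasurableSpace Ω} {X : ℝ≥0 → Ω → E}

/-- The process is the pointwise limit of its values at the next grid point, by right-continuity,
and each approximation involves only countably many times. -/
theorem measurable_uncurry_of_isCadlag (hX : ∀ t, Measurable (X t))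
    (hc : ∀ ω, IsCadlag fun t => X t ω) : Measurable fun p : ℝ≥0 × Ω => X p.1 p.2 := by
  have hlim : ∀ p : ℝ≥0 × Ω, Tendsto (fun n => X (nextGridPoint n p.1) p.2) atTop
      (𝓝 (X p.1 p.2)) := fun p =>
    ((hc p.2).tendsto_right p.1).comp (tendsto_nextGridPoint p.1)
  refine measurable_of_tendsto_metrizable (fun n => ?_) (tendsto_pi_nhds.2 hlim)
  have h1 : ∀ r : ℕ → ℝ≥0, Measurable fun p : ℕ × Ω => X (r p.1) p.2 :=
    fun r => measurable_from_prod_countable_right fun k => hX (r k)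
  have h2 : Measurable fun p : ℝ≥0 × Ω => (⌊((n : ℝ≥0) + 1) * p.1⌋₊, p.2) :=
    (Nat.measurable_floor.comp (measurable_fst.const_mul _)).prodMk measurable_snd
  have h3 := (h1 fun k => ((k : ℝ≥0) + 1) / ((n : ℝ≥0) + 1)).comp h2
  unfold nextGridPoint
  exact h3

theorem IsCadlag.measurable {ω : ℝ≥0 → E} (h : IsCadlag ω) : Measurable ω :=
  (measurable_uncurry_of_isCadlag (Ω := Unit) (mΩ := inferInstance) (X := fun t _ => ω t)
    (fun _ => measurable_const) fun _ => h).comp (measurable_id.prodMk (measurable_const (a := ())))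

theorem measurable_uncurry_leftLim (hX : ∀ t, Measurable (X t))
    (hc : ∀ ω, IsCadlag fun t => X t ω) :
    Measurable fun p : ℝ≥0 × Ω => Function.leftLim (fun t => X t p.2) p.1 := by
  refine measurable_of_tendsto_metrizable (f := fun (n : ℕ) (p : ℝ≥0 × Ω) =>
    X ((n : ℝ≥0) / ((n : ℝ≥0) + 1) * p.1) p.2) (fun n => ?_)
    (tendsto_pi_nhds.2 fun p => (hc p.2).tendsto_mul_leftLim p.1)
  exact (measurable_uncurry_of_isCadlag hX hc).comp
    ((measurable_fst.const_mul _).prodMk measurable_snd)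

theorem measurable_leftLim (hX : ∀ t, Measurable (X t))
    (hc : ∀ ω, IsCadlag fun t => X t ω) (t : ℝ≥0) :
    Measurable fun ω => Function.leftLim (fun t => X t ω) t :=
  (measurable_uncurry_leftLim hX hc).comp measurable_prodMk_left

variable [SecondCountableTopology E]

theorem measurable_uncurry_iSup_nndist (hX : ∀ t, Measurable (X t))
    (hc : ∀ ω, IsCadlag fun t => X t ω) (x : E) :
    Measurable fun p : ℝ≥0 × Ω => ⨆ s : Iic p.1, nndist (X s p.2) x := by
  refine measurable_of_Ioi fun b => ?_
  have : (fun p : ℝ≥0 × Ω => ⨆ s : Iic p.1, nndist (X s p.2) x) ⁻¹' Ioi b =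
      ⋃ c : ℚ≥0, {p | c ≤ 1 ∧ b < nndist (X ((c : ℝ≥0) * p.1) p.2) x} := by
    ext p
    simpa using (hc p.2).lt_iSup_nndist_iff x p.1 b
  rw [this]
  refine MeasurableSet.iUnion fun c => (MeasurableSet.const _).inter ?_
  exact (((measurable_uncurry_of_isCadlag hX hc).comp
    ((measurable_fst.const_mul (c : ℝ≥0)).prodMk measurable_snd)).nndist
      (measurable_const (a := x))) measurableSet_Ioi

theorem measurable_exitTime (hX : ∀ t, Measurable (X t))
    (hc : ∀ ω, IsCadlag fun t => X t ω) (p c : ℝ≥0) :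
    Measurable fun ω => exitTime p c fun t => X t ω := by
  set A : ℚ≥0 → Set Ω := fun r => {ω | p < (r : ℝ≥0) ∧ c < nndist (X r ω) (X p ω)} with hA
  have hAm : ∀ r, MeasurableSet (A r) := fun r => (MeasurableSet.const _).inter
    (((hX r).nndist (hX p)) measurableSet_Ioi)
  have key : ∀ (ω : Ω) (b v : ℝ≥0), p < v → c < nndist (X v ω) (X p ω) → v < b →
      ∃ r : ℚ≥0, (r : ℝ≥0) < b ∧ ω ∈ A r := by
    intro ω b v hpv hcv hvb
    have h1 : ∀ᶠ s in 𝓝[>] v, c < nndist (X s ω) (X p ω) :=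
      (((hc ω).tendsto_right v).nndist tendsto_const_nhds).eventually (lt_mem_nhds hcv)
    obtain ⟨u, hu, hsu⟩ := (mem_nhdsGT_iff_exists_Ioo_subset' hvb).1 h1
    obtain ⟨r, hr1, hr2⟩ := NNReal.exists_nnrat_btwn (lt_min hu hvb : v < min u b)
    rw [lt_min_iff] at hr2
    exact ⟨r, hr2.2, hpv.trans hr1, hsu ⟨hr1, hr2.1⟩⟩
  refine measurable_of_Iio fun b => ?_
  -- The second piece records the default value: the infimum of the empty set is `0`.
  have : (fun ω => exitTime p c fun t => X t ω) ⁻¹' Iio b =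
      (⋃ r : ℚ≥0, {ω | (r : ℝ≥0) < b ∧ ω ∈ A r}) ∪ ((⋃ r, A r)ᶜ ∩ {_ω | 0 < b}) := by
    ext ω
    simp only [mem_preimage, mem_Iio, mem_union, mem_iUnion, mem_ofPred_eq, mem_inter_iff,
      mem_compl_iff, exitTime]
    rcases Set.eq_empty_or_nonempty {v | p < v ∧ c < nndist (X v ω) (X p ω)} with h | h
    · have hn : ¬ ∃ r, ω ∈ A r := by
        rintro ⟨r, hr⟩
        exact (h ▸ (show (r : ℝ≥0) ∈ {v | p < v ∧ c < nndist (X v ω) (X p ω)} from hr) :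
          (r : ℝ≥0) ∈ (∅ : Set ℝ≥0))
      rw [h, NNReal.sInf_empty]
      simp only [hn, not_false_eq_true, true_and]
      constructor
      · exact fun hb => Or.inr hb
      · rintro (⟨r, -, hr⟩ | hb)
        · exact absurd ⟨r, hr⟩ hn
        · exact hb
    · rw [csInf_lt_iff (OrderBot.bddBelow _) h]
      constructor
      · rintro ⟨v, ⟨hpv, hcv⟩, hvb⟩
        exact Or.inl (key ω b v hpv hcv hvb)
      · rintro (⟨r, hrb, hr⟩ | ⟨hn, -⟩)
        · exact ⟨r, hr, hrb⟩
        · obtain ⟨v, hpv, hcv⟩ := h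
          obtain ⟨r, -, hr⟩ := key ω (v + 1) v hpv hcv (lt_add_one v)
          exact absurd ⟨r, hr⟩ hn
  rw [this]
  exact (MeasurableSet.iUnion fun r => (MeasurableSet.const _).inter (hAm r)).union
    ((MeasurableSet.iUnion hAm).compl.inter (MeasurableSet.const _))

/-- Quantifiers over jump times preserve measurability, because the jump times are exhausted by
countably many exit times. -/
theorem measurableSet_exists_jump (hX : ∀ t, Measurable (X t))
    (hc : ∀ ω, IsCadlag fun t => X t ω) {B : Set (ℝ≥0 × Ω)} (hB : MeasurableSet B)
    (hjump : ∀ t ω, (t, ω) ∈ B → Function.leftLim (fun t => X t ω) t ≠ X t ω) :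
    MeasurableSet {ω | ∃ t, (t, ω) ∈ B} := by
  have : {ω | ∃ t, (t, ω) ∈ B} =
      ⋃ pc : ℚ≥0 × ℚ≥0, {ω | (exitTime (pc.1 : ℝ≥0) (pc.2 : ℝ≥0) (fun t => X t ω), ω) ∈ B} := by
    ext ω
    simp only [mem_ofPred_eq, mem_iUnion]
    constructor
    · rintro ⟨t, ht⟩
      obtain ⟨p, c, hpc⟩ := (hc ω).exists_exitTime_eq (hjump t ω ht)
      exact ⟨(p, c), by rwa [hpc]⟩
    · rintro ⟨pc, h⟩
      exact ⟨_, h⟩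
  rw [this]
  exact MeasurableSet.iUnion fun pc => ((measurable_exitTime hX hc _ _).prodMk measurable_id) hB

/-- Measurable selection of a jump time. -/
theorem exists_measurable_jump (hX : ∀ t, Measurable (X t))
    (hc : ∀ ω, IsCadlag fun t => X t ω) {B : Set (ℝ≥0 × Ω)} (hB : MeasurableSet B)
    (hjump : ∀ t ω, (t, ω) ∈ B → Function.leftLim (fun t => X t ω) t ≠ X t ω) :
    ∃ S : Ω → ℝ≥0, Measurable S ∧ ∀ ω, (∃ t, (t, ω) ∈ B) → (S ω, ω) ∈ B := by
  classical
  obtain ⟨e, he⟩ := exists_surjective_nat (ℚ≥0 × ℚ≥0)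
  set T : ℕ → Ω → ℝ≥0 := fun k ω => exitTime ((e k).1 : ℝ≥0) ((e k).2 : ℝ≥0) (fun t => X t ω)
  have hT : ∀ k, Measurable (T k) := fun k => measurable_exitTime hX hc _ _
  set N : Set Ω := {ω | ∃ t, (t, ω) ∈ B}
  have hN : MeasurableSet N := measurableSet_exists_jump hX hc hB hjump
  have hex : ∀ ω, ∃ k, ω ∉ N ∨ (T k ω, ω) ∈ B := by
    intro ω
    by_cases hω : ω ∈ N
    · obtain ⟨t, ht⟩ := hω
      obtain ⟨p, c, hpc⟩ := (hc ω).exists_exitTime_eq (hjump t ω ht)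
      obtain ⟨k, hk⟩ := he (p, c)
      refine ⟨k, Or.inr ?_⟩
      have : T k ω = t := by simp only [T, hk, hpc]
      rwa [this]
    · exact ⟨0, Or.inl hω⟩
  -- Selection amounts to taking the first exit time in a fixed enumeration that lands in `B`;
  -- outside `N` the index is irrelevant.
  have hfind : Measurable fun ω => Nat.find (hex ω) := measurable_find hex fun k =>
    hN.compl.union (((hT k).prodMk measurable_id) hB)
  refine ⟨fun ω => T (Nat.find (hex ω)) ω, ?_, fun ω hω => ?_⟩
  · have : Measurable fun p : ℕ × Ω => T p.1 p.2 := measurable_from_prod_countable_right hT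
    exact this.comp (hfind.prodMk measurable_id)
  · exact (Nat.find_spec (hex ω)).resolve_left (fun h => h hω)

end Measurability

/-! ### Uniformity over the laws of the control variables, and portmanteau -/

/-- Equal laws, or laws that are relatively compact in `M_m(U)`, are uniformly continuous from
above at the empty set. In the second case this is Dini's argument on the compact closure. -/
theorem exists_forall_measure_le_of_iInter_eq_empty {U : Type*} [MeasurableSpace U]
    {μ : ℕ → Measure U} [∀ n, IsProbabilityMeasure (μ n)]
    (hμ : (∀ n, μ n = μ 0) ∨
      IsRelativelyCompactInMm {ν : ProbabilityMeasure U | ∃ n, (ν : Measure U) = μ n})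
    {B : ℕ → Set U} (hB : ∀ k, MeasurableSet (B k)) (hanti : Antitone B)
    (hempty : ⋂ k, B k = ∅) {ε : ℝ≥0∞} (hε : 0 < ε) : ∃ k, ∀ n, μ n (B k) ≤ ε := by
  have hlim : ∀ (ν : Measure U) [IsProbabilityMeasure ν],
      Tendsto (fun k => ν (B k)) atTop (𝓝 0) := by
    intro ν _
    have := tendsto_measure_iInter_atTop (μ := ν) (fun k => (hB k).nullMeasurableSet) hanti
      ⟨0, measure_ne_top _ _⟩
    rwa [hempty, measure_empty] at this
  rcases hμ with hμ | hμ
  · obtain ⟨k, hk⟩ := ((hlim (μ 0)).eventually (gt_mem_nhds hε)).exists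
    exact ⟨k, fun n => by rw [hμ n]; exact hk.le⟩
  · let _ : TopologicalSpace (ProbabilityMeasure U) := boundedMeasurableTopology U
    obtain ⟨r, hr0, hrε⟩ := ENNReal.lt_iff_exists_nnreal_btwn.1 hε
    have hr0' : (0 : ℝ) < r := by exact_mod_cast hr0
    -- These sets are open, increase with `k` and cover everything, as `B k` shrinks to the empty
    -- set; compactness of the closure then selects a single `k`.
    set V : ℕ → Set (ProbabilityMeasure U) := fun k =>
      {ν | ∫ u, (B k).indicator (fun _ => (1 : ℝ)) u ∂(ν : Measure U) < r} with hV
    have hint : ∀ (ν : ProbabilityMeasure U) k,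
        ∫ u, (B k).indicator (fun _ => (1 : ℝ)) u ∂(ν : Measure U) =
          ((ν : Measure U) (B k)).toReal := fun ν k => by
      rw [integral_indicator_const _ (hB k)]
      simp [Measure.real]
    have hVm : ∀ (ν : ProbabilityMeasure U) k, ν ∈ V k ↔ (ν : Measure U) (B k) < r := by
      intro ν k
      rw [hV, mem_ofPred_eq, hint, ← ENNReal.toReal_lt_toReal (measure_ne_top _ _)
        ENNReal.coe_ne_top, ENNReal.coe_toReal]
    have hopen : ∀ k, IsOpen (V k) := by
      intro k
      let f : {f : U → ℝ // Measurable f ∧ ∃ C : ℝ, ∀ u, |f u| ≤ C} :=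
        ⟨(B k).indicator fun _ => 1, measurable_const.indicator (hB k), 1, fun u => by
          by_cases hu : u ∈ B k <;> simp [hu]⟩
      have hcont : Continuous fun ν : ProbabilityMeasure U => ∫ u, f.1 u ∂(ν : Measure U) :=
        continuous_iInf_dom (i := f) continuous_induced_dom
      exact isOpen_lt hcont continuous_const
    obtain ⟨k, hk⟩ := IsCompact.elim_directed_cover hμ V hopen
      (fun ν _ => by
        obtain ⟨k, hk⟩ := ((hlim (ν : Measure U)).eventually (gt_mem_nhds hr0)).exists
        exact mem_iUnion.2 ⟨k, (hVm ν k).2 hk⟩)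
      (directed_of_isDirected_le fun i j hij ν hν =>
        (hVm ν j).2 ((measure_mono (hanti hij)).trans_lt ((hVm ν i).1 hν)))
    refine ⟨k, fun n => ?_⟩
    have hmem : (⟨μ n, inferInstance⟩ : ProbabilityMeasure U) ∈
        {ν : ProbabilityMeasure U | ∃ n, (ν : Measure U) = μ n} := ⟨n, rfl⟩
    have := hk (subset_closure hmem)
    exact ((hVm _ k).1 this).le.trans hrε.le

/-- If the sections of the sets `G k ⊆ U × ℝ≥0` are eventually empty, then the probability that
`(L k, S k)` belongs to `G k` tends to zero, whatever the random times `S k` are. -/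
theorem tendsto_measure_prodMk_mem_of_eventually_empty {U : Type*} [MeasurableSpace U]
    {Ω : ℕ → Type*} [∀ k, MeasurableSpace (Ω k)] {P : ∀ k, Measure (Ω k)}
    [∀ k, IsProbabilityMeasure (P k)] {L : ∀ k, Ω k → U} (hL : ∀ k, Measurable (L k))
    {S : ∀ k, Ω k → ℝ≥0} (hS : ∀ k, Measurable (S k))
    (hlaw : ∀ B : ℕ → Set U, (∀ m, MeasurableSet (B m)) → Antitone B → ⋂ m, B m = ∅ →
      ∀ ε : ℝ≥0∞, 0 < ε → ∃ m, ∀ k, (P k).map (L k) (B m) ≤ ε)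
    {G : ℕ → Set (U × ℝ≥0)} (hG : ∀ k, MeasurableSet (G k))
    (hempty : ∀ u, ∀ᶠ k in atTop, ∀ s, (u, s) ∉ G k) :
    Tendsto (fun k => P k {ω | (L k ω, S k ω) ∈ G k}) atTop (𝓝 0) := by
  -- The projection of `G k` to `U` need not be measurable. The conditional probability that `(L k,
  -- S k)` lies in `G k`, given `L k = u`, is measurable in `u` and vanishes whenever the section of
  -- `G k` at `u` is empty.
  set c : ℕ → U → ℝ≥0∞ := fun k u => condDistrib (S k) (L k) (P k) u (Prod.mk u ⁻¹' G k) with hc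
  have hcm : ∀ k, Measurable (c k) := fun k => Kernel.measurable_kernel_prodMk_left (hG k)
  have hcP : ∀ k, P k {ω | (L k ω, S k ω) ∈ G k} = ∫⁻ u, c k u ∂((P k).map (L k)) := by
    intro k
    rw [← Measure.compProd_apply (hG k), compProd_map_condDistrib (hS k).aemeasurable,
      Measure.map_apply ((hL k).prodMk (hS k)) (hG k)]
    rfl
  set B : ℕ → Set U := fun m => ⋃ k, ⋃ _ : m ≤ k, {u | c k u ≠ 0} with hB
  have hBm : ∀ m, MeasurableSet (B m) := fun m =>
    MeasurableSet.iUnion fun k => MeasurableSet.iUnion fun _ =>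
      (measurableSet_singleton (0 : ℝ≥0∞)).compl.preimage (hcm k)
  have hBanti : Antitone B := fun m m' hmm =>
    iUnion_mono fun k => iUnion_mono' fun hk => ⟨hmm.trans hk, le_rfl⟩
  have hBempty : ⋂ m, B m = ∅ := by
    refine eq_empty_of_forall_notMem fun u hu => ?_
    obtain ⟨m, hm⟩ := eventually_atTop.1 (hempty u)
    have h1 := mem_iInter.1 hu m
    simp only [hB, mem_iUnion, mem_ofPred_eq] at h1
    obtain ⟨k, hmk, hk⟩ := h1
    refine hk ?_
    have : Prod.mk u ⁻¹' G k = ∅ := eq_empty_of_forall_notMem fun s hs => hm k hmk s hs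
    simp only [hc, this, measure_empty]
  refine ENNReal.tendsto_nhds_zero.2 fun ε hε => ?_
  obtain ⟨m, hm⟩ := hlaw B hBm hBanti hBempty ε hε
  filter_upwards [eventually_ge_atTop m] with k hk
  rw [hcP]
  refine le_trans ?_ (hm k)
  rw [← lintegral_indicator_one (hBm m)]
  refine lintegral_mono fun u => ?_
  by_cases hu : u ∈ B m
  · rw [indicator_of_mem hu]
    exact prob_le_one
  · rw [indicator_of_notMem hu]
    simp only [hB, mem_iUnion, mem_ofPred_eq, not_exists, not_not] at hu
    exact (hu k hk).le

/-- If `G k` increases and every point is interior to some `G k`, then a sequence that converges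
in distribution eventually lies in some `G k` with high probability. -/
theorem MeasureTheory.TendstoInDistribution.exists_eventually_measure_notMem_le
    {S : Type*} [TopologicalSpace S] [TopologicalSpace.PseudoMetrizableSpace S]
    [MeasurableSpace S] [BorelSpace S]
    {Ω : Type*} [MeasurableSpace Ω] {P : Measure Ω} [IsProbabilityMeasure P] {Z : Ω → S}
    {Ωn : ℕ → Type*} [∀ n, MeasurableSpace (Ωn n)] {Pn : ∀ n, Measure (Ωn n)}
    [∀ n, IsProbabilityMeasure (Pn n)] {Zn : ∀ n, Ωn n → S}
    (h : TendstoInDistribution Zn atTop Z Pn P) {G : ℕ → Set S} (hmono : Monotone G)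
    (hG : ∀ x, ∃ k, G k ∈ 𝓝 x) {ε : ℝ≥0∞} (hε : 0 < ε) :
    ∃ k, ∀ᶠ n in atTop, Pn n {ω | Zn n ω ∉ G k} ≤ ε := by
  set F : ℕ → Set S := fun k => (interior (G k))ᶜ with hF
  have hFc : ∀ k, IsClosed (F k) := fun k => isOpen_interior.isClosed_compl
  have hFanti : Antitone F := fun i j hij => compl_subset_compl.2 (interior_mono (hmono hij))
  have hFempty : ⋂ k, F k = ∅ := by
    refine eq_empty_of_forall_notMem fun x hx => ?_
    obtain ⟨k, hk⟩ := hG x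
    exact mem_iInter.1 hx k (mem_interior_iff_mem_nhds.2 hk)
  have : IsProbabilityMeasure (P.map Z) := Measure.isProbabilityMeasure_map h.aemeasurable_limit
  have hlim := tendsto_measure_iInter_atTop (μ := P.map Z)
    (fun k => (hFc k).measurableSet.nullMeasurableSet) hFanti ⟨0, measure_ne_top _ _⟩
  rw [hFempty, measure_empty] at hlim
  obtain ⟨k, hk⟩ := (hlim.eventually (gt_mem_nhds hε)).exists
  refine ⟨k, ?_⟩
  have h1 := ProbabilityMeasure.limsup_measure_closed_le_of_tendsto h.tendsto (hFc k)
  filter_upwards [eventually_lt_of_limsup_lt (h1.trans_lt hk)] with n hn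
  refine le_trans ?_ hn.le
  change _ ≤ (Pn n).map (Zn n) (F k)
  rw [Measure.map_apply_of_aemeasurable (h.forall_aemeasurable n) (hFc k).measurableSet]
  exact measure_mono fun ω hω => fun h' => hω (interior_subset h')

namespace SkorokhodSpace

variable {E : Type*} [MetricSpace E]

/-- Local boundedness in the path space; with convergence in distribution it bounds the running
suprema of `Xⁿ` by a constant with high probability. -/
theorem exists_forall_nndist_le_mem_nhds (ω : SkorokhodSpace E) (x : E) (T : ℝ≥0) :
    ∃ K : ℕ, {η : SkorokhodSpace E | ∀ s ≤ T, nndist (η s) x ≤ K} ∈ 𝓝 ω := by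
  obtain ⟨K, hK⟩ := ω.isCadlag.bddAbove_nndist x (T + 1)
  obtain ⟨k, hk⟩ := exists_nat_ge (K + 1)
  refine ⟨k, mem_of_superset (basicNhd_mem_nhds ω (T + 1 + 1) one_pos) fun η hη s hs => ?_⟩
  obtain ⟨lam, h⟩ := mem_basicNhd_symm le_rfl hη
  have h1 := h s (hs.trans (le_add_of_nonneg_right zero_le))
  have h2 : lam s ≤ T + 1 := by
    have h3 := h1.1
    rw [NNReal.dist_eq, abs_lt] at h3
    rw [← NNReal.coe_le_coe] at hs ⊢
    push_cast
    linarith [h3.2]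
  have h4 := hK _ h2
  refine le_trans ?_ hk
  rw [← NNReal.coe_le_coe] at h4 ⊢
  push_cast at h4 ⊢
  have := dist_triangle_left (η s) x (ω (lam s))
  linarith [h1.2]

end SkorokhodSpace

/-! ### No large jumps near, but off, a fixed time -/

section JumpControl

variable {E : Type*} [MetricSpace E] [SecondCountableTopology E]
  [MeasurableSpace E] [BorelSpace E] {U : Type*} [MeasurableSpace U]

/-- The condition over uncountably many times is measurable because it can fail only at a jump time.
This is needed to pass to the probability of the complement. -/
theorem measurableSet_mem_jumpControlSet {𝔲 : U → ℝ≥0 → ℝ≥0}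
    (h𝔲 : Measurable (Function.uncurry 𝔲)) {κ : ℝ≥0 → ℝ≥0} (hκ : Continuous κ) (x₀ : E)
    {Ω : Type*} [MeasurableSpace Ω] {X : ℝ≥0 → Ω → E} (hX : ∀ t, Measurable (X t))
    (hc : ∀ ω, IsCadlag fun t => X t ω) {L : Ω → U} (hL : Measurable L) :
    MeasurableSet {ω | (L ω, pathMap X hc ω) ∈ jumpControlSet 𝔲 κ x₀} := by
  set B : Set (ℝ≥0 × Ω) := {p | 0 < p.1 ∧
    𝔲 (L p.2) p.1 * κ (⨆ s : Iic p.1, nndist (X s p.2) x₀) <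
      nndist (X p.1 p.2) (Function.leftLim (fun t => X t p.2) p.1)} with hB
  have hBm : MeasurableSet B := by
    have h1 : Measurable fun p : ℝ≥0 × Ω =>
        𝔲 (L p.2) p.1 * κ (⨆ s : Iic p.1, nndist (X s p.2) x₀) :=
      (h𝔲.comp ((hL.comp measurable_snd).prodMk measurable_fst)).mul
        (hκ.measurable.comp (measurable_uncurry_iSup_nndist hX hc x₀))
    have h2 : Measurable fun p : ℝ≥0 × Ω =>
        nndist (X p.1 p.2) (Function.leftLim (fun t => X t p.2) p.1) :=
      (measurable_uncurry_of_isCadlag hX hc).nndist (measurable_uncurry_leftLim hX hc)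
    have h3 := measurableSet_lt h1 h2
    exact (measurable_fst measurableSet_Ioi).inter h3
  have := (measurableSet_exists_jump hX hc hBm ?_).compl
  · convert this using 1
    ext ω
    simp only [mem_compl_iff, mem_ofPred_eq, not_exists, hB, not_and, not_lt]
    rfl
  · rintro t ω ⟨-, ht⟩ h
    rw [h, nndist_self] at ht
    exact not_lt_zero ht

/-- Near a fixed time `t > 0`, but not at `t`, the processes `Xⁿ` have no large jumps with high
probability: at a jump time `S` one would have `a < 𝔲 (Lⁿ) S * κ K`, which excludes `S` close to
`t` for each value of the control variable. -/
theorem exists_eventually_measure_jump_le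
    {Ω : Type*} [MeasurableSpace Ω] {P : Measure Ω} [IsProbabilityMeasure P]
    {X : ℝ≥0 → Ω → E} (hXcad : ∀ ω, IsCadlag (fun t => X t ω))
    {Ωn : ℕ → Type*} [∀ n, MeasurableSpace (Ωn n)] {Pn : ∀ n, Measure (Ωn n)}
    [∀ n, IsProbabilityMeasure (Pn n)]
    {Xn : ∀ n, ℝ≥0 → Ωn n → E} (hXn : ∀ n t, Measurable (Xn n t))
    (hXncad : ∀ n ω, IsCadlag (fun t => Xn n t ω))
    {𝔲 : U → ℝ≥0 → ℝ≥0} (h𝔲 : Measurable (Function.uncurry 𝔲))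
    (h𝔲lim : ∀ (u : U) (t : ℝ≥0), 0 < t →
      Tendsto (fun ε : ℝ => ⨆ s ∈ {s : ℝ≥0 | s ≠ t ∧ (t : ℝ) - ε ≤ s ∧ (s : ℝ) ≤ t + ε},
        (𝔲 u s : ℝ≥0∞)) (𝓝[>] 0) (𝓝 0))
    {κ : ℝ≥0 → ℝ≥0} (hκmono : Monotone κ) (hκcont : Continuous κ) {x₀ : E}
    (hconv : TendstoInDistribution (fun n => pathMap (Xn n) (hXncad n)) atTop
      (pathMap X hXcad) Pn P)
    {L : ∀ n, Ωn n → U} (hL : ∀ n, Measurable (L n))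
    (hA : Tendsto (fun n => Pn n {ω | (L n ω, pathMap (Xn n) (hXncad n) ω) ∈
      jumpControlSet 𝔲 κ x₀}) atTop (𝓝 1))
    (hLlaw : (∀ n, (Pn n).map (L n) = (Pn 0).map (L 0)) ∨
      IsRelativelyCompactInMm {ν : ProbabilityMeasure U | ∃ n, (ν : Measure U) =
        (Pn n).map (L n)})
    {t : ℝ≥0} (ht : 0 < t) {a : ℝ≥0} (ha : 0 < a) {ε : ℝ≥0∞} (hε : 0 < ε) :
    ∃ δ : ℝ, 0 < δ ∧ ∀ᶠ n in atTop, Pn n {ω | ∃ s, s ≠ t ∧ dist s t ≤ δ ∧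
      a < nndist (Xn n s ω) (Function.leftLim (fun v => Xn n v ω) s)} ≤ ε := by
  have hε3 : 0 < ε / 3 := ENNReal.div_pos hε.ne' (by simp)
  obtain ⟨K, hK⟩ := hconv.exists_eventually_measure_notMem_le
    (G := fun K : ℕ => {η : SkorokhodSpace E | ∀ s ≤ t + 1, nndist (η s) x₀ ≤ K})
    (fun i j hij η hη s hs => (hη s hs).trans (by exact_mod_cast hij))
    (fun ω => ω.exists_forall_nndist_le_mem_nhds x₀ (t + 1)) hε3
  set N : ∀ n, Set (Ωn n) := fun n => {ω | (L n ω, pathMap (Xn n) (hXncad n) ω) ∈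
    jumpControlSet 𝔲 κ x₀} with hN
  have hNm : ∀ n, MeasurableSet (N n) := fun n =>
    measurableSet_mem_jumpControlSet h𝔲 hκcont x₀ (hXn n) (hXncad n) (hL n)
  have hNc : ∀ᶠ n in atTop, Pn n (N n)ᶜ ≤ ε / 3 := by
    have h1 : Tendsto (fun n => 1 - Pn n (N n)) atTop (𝓝 (1 - 1)) :=
      ENNReal.Tendsto.sub tendsto_const_nhds hA (Or.inl ENNReal.one_ne_top)
    rw [tsub_self] at h1
    filter_upwards [h1.eventually (gt_mem_nhds hε3)] with n hn
    rw [prob_compl_eq_one_sub (hNm n)]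
    exact hn.le
  by_contra! hcon
  have hδ : ∀ k : ℕ, (0 : ℝ) < 1 / ((k : ℝ) + 1) := fun k => by positivity
  -- The indices `n k` need not increase with `k`. This is harmless because the control of the laws
  -- of `L` is uniform in the index.
  have hchoose : ∀ k : ℕ, ∃ n, ε < Pn n {ω | ∃ s, s ≠ t ∧ dist s t ≤ 1 / ((k : ℝ) + 1) ∧
      a < nndist (Xn n s ω) (Function.leftLim (fun v => Xn n v ω) s)} ∧
      Pn n {ω | pathMap (Xn n) (hXncad n) ω ∉
        {η : SkorokhodSpace E | ∀ s ≤ t + 1, nndist (η s) x₀ ≤ K}} ≤ ε / 3 ∧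
      Pn n (N n)ᶜ ≤ ε / 3 := fun k =>
    ((hcon _ (hδ k)).and_eventually (hK.and hNc)).exists
  choose n hn1 hn2 hn3 using hchoose
  -- Replacing the running supremum by `K` leaves a condition on the control variable and the time
  -- alone, which is the set `G k`. Off the two exceptional events every large jump at distance at
  -- most `1 / (k + 1) ≤ 1` from `t` satisfies it, since `K` bounds the path up to `t + 1`.
  set B : ∀ k, Set (ℝ≥0 × Ωn (n k)) := fun k => {p | (p.1 ≠ t ∧ dist p.1 t ≤ 1 / ((k : ℝ) + 1)) ∧
    a < nndist (Xn (n k) p.1 p.2) (Function.leftLim (fun v => Xn (n k) v p.2) p.1) ∧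
    a < 𝔲 (L (n k) p.2) p.1 * κ K} with hB
  set G : ℕ → Set (U × ℝ≥0) := fun k => {p | (p.2 ≠ t ∧ dist p.2 t ≤ 1 / ((k : ℝ) + 1)) ∧
    a < 𝔲 p.1 p.2 * κ K} with hG
  have hI : ∀ k : ℕ, MeasurableSet {s : ℝ≥0 | s ≠ t ∧ dist s t ≤ 1 / ((k : ℝ) + 1)} := fun k =>
    (measurableSet_singleton t).compl.inter Metric.isClosed_closedBall.measurableSet
  have hBm : ∀ k, MeasurableSet (B k) := by
    intro k
    have h1 : Measurable fun p : ℝ≥0 × Ωn (n k) => 𝔲 (L (n k) p.2) p.1 * κ K :=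
      (h𝔲.comp (((hL _).comp measurable_snd).prodMk measurable_fst)).mul measurable_const
    have h2 : Measurable fun p : ℝ≥0 × Ωn (n k) =>
        nndist (Xn (n k) p.1 p.2) (Function.leftLim (fun v => Xn (n k) v p.2) p.1) :=
      (measurable_uncurry_of_isCadlag (hXn _) (hXncad _)).nndist
        (measurable_uncurry_leftLim (hXn _) (hXncad _))
    exact (measurable_fst (hI k)).inter ((h2 measurableSet_Ioi).inter (h1 measurableSet_Ioi))
  have hGm : ∀ k, MeasurableSet (G k) := fun k => (measurable_snd (hI k)).inter
    ((h𝔲.mul (measurable_const (a := κ K))) measurableSet_Ioi)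
  have hsel := fun k => exists_measurable_jump (hXn (n k)) (hXncad (n k)) (hBm k) (by
    rintro s ω ⟨-, hs, -⟩ h
    rw [h, nndist_self] at hs
    exact not_lt_zero hs)
  choose S hSm hS using hsel
  have hlim := tendsto_measure_prodMk_mem_of_eventually_empty (P := fun k => Pn (n k))
    (L := fun k => L (n k)) (fun k => hL (n k)) hSm
    (fun C hC hCanti hCempty ε' hε' => by
      have : ∀ m, IsProbabilityMeasure ((Pn m).map (L m)) := fun m =>
        Measure.isProbabilityMeasure_map (hL m).aemeasurable
      obtain ⟨m, hm⟩ := exists_forall_measure_le_of_iInter_eq_empty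
        (μ := fun m => (Pn m).map (L m)) hLlaw hC hCanti hCempty hε'
      exact ⟨m, fun k => hm (n k)⟩)
    hGm (fun u => by
      have h1 : Tendsto (fun k : ℕ => (1 : ℝ) / ((k : ℝ) + 1)) atTop (𝓝[>] 0) :=
        tendsto_nhdsWithin_iff.2
          ⟨tendsto_one_div_add_atTop_nhds_zero_nat, Eventually.of_forall hδ⟩
      have h2 := ENNReal.Tendsto.mul_const (b := (κ K : ℝ≥0∞)) ((h𝔲lim u t ht).comp h1)
        (Or.inr ENNReal.coe_ne_top)
      rw [zero_mul] at h2
      have ha' : (0 : ℝ≥0∞) < a := by exact_mod_cast ha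
      filter_upwards [h2.eventually (gt_mem_nhds ha')] with k
        hk s hs
      obtain ⟨⟨hst, hd⟩, has⟩ := hs
      rw [NNReal.dist_eq, abs_le] at hd
      have h3 : (𝔲 u s : ℝ≥0∞) ≤ ⨆ s ∈ {s : ℝ≥0 | s ≠ t ∧ (t : ℝ) - 1 / ((k : ℝ) + 1) ≤ s ∧
          (s : ℝ) ≤ t + 1 / ((k : ℝ) + 1)}, (𝔲 u s : ℝ≥0∞) :=
        le_iSup₂_of_le s ⟨hst, by linarith [hd.1], by linarith [hd.2]⟩ le_rfl
      have h4 : ((𝔲 u s * κ K : ℝ≥0) : ℝ≥0∞) < a := by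
        rw [ENNReal.coe_mul]
        exact (mul_le_mul_left h3 _).trans_lt hk
      exact lt_asymm has (by exact_mod_cast h4))
  obtain ⟨k, hk⟩ := (hlim.eventually (gt_mem_nhds hε3)).exists
  refine (hn1 k).not_ge ?_
  calc _ ≤ Pn (n k) ({ω | (L (n k) ω, S k ω) ∈ G k} ∪ {ω | pathMap (Xn (n k)) (hXncad (n k)) ω ∉
        {η : SkorokhodSpace E | ∀ s ≤ t + 1, nndist (η s) x₀ ≤ K}} ∪ (N (n k))ᶜ) := by
        refine measure_mono fun ω hω => ?_
        by_contra hω'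
        simp only [mem_union, mem_compl_iff, not_or, mem_ofPred_eq, not_not] at hω'
        obtain ⟨⟨hω1, hω2⟩, hω3⟩ := hω'
        refine hω1 ?_
        have hωB := hS k ω (by
          obtain ⟨s, hst, hd, has⟩ := hω
          refine ⟨s, ⟨hst, hd⟩, has, ?_⟩
          have hs0 : 0 < s := by
            rw [pos_iff_ne_zero]
            rintro rfl
            rw [IsCadlag.leftLim_zero, nndist_self] at has
            exact not_lt_zero has
          refine has.trans_le ((hω3 s hs0).trans ?_)
          refine mul_le_mul_right (hκmono ?_) _
          have : Nonempty (Iic s) := ⟨⟨s, le_refl s⟩⟩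
          refine ciSup_le fun v => hω2 _ ((show v.1 ≤ s from v.2).trans ?_)
          rw [NNReal.dist_eq, abs_le] at hd
          rw [← NNReal.coe_le_coe]
          push_cast
          have : (1 : ℝ) / ((k : ℝ) + 1) ≤ 1 := by
            rw [div_le_one (by positivity)]; linarith [(Nat.cast_nonneg k : (0 : ℝ) ≤ k)]
          linarith [hd.2])
        exact ⟨hωB.1, hωB.2.2⟩
    _ ≤ ε / 3 + ε / 3 + ε / 3 :=
        (measure_union_le _ _).trans (add_le_add ((measure_union_le _ _).trans
          (add_le_add hk.le (hn2 k))) (hn3 k))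
    _ = ε := ENNReal.add_thirds ε

end JumpControl

/-! ### One-sided oscillation in a `J₁` neighbourhood -/

namespace SkorokhodSpace

variable {E : Type*} [MetricSpace E]

/-- The paths whose oscillation on each of the two sides of `t` is at most `2 * a` within
distance `δ` of `t`. -/
def smallOsc (E : Type*) [MetricSpace E] (t a : ℝ≥0) (δ : ℝ) : Set (SkorokhodSpace E) :=
  {η | ∀ w v, dist w t ≤ δ → dist v t ≤ δ → (t ≤ w ↔ t ≤ v) → dist (η w) (η v) ≤ 2 * a}

/-- The paths that jump by more than `a` within distance `δ` of `t`, but not at `t`. -/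
def jumpNear (E : Type*) [MetricSpace E] (t a : ℝ≥0) (δ : ℝ) : Set (SkorokhodSpace E) :=
  {η | ∃ s, s ≠ t ∧ dist s t ≤ δ ∧ a < nndist (η s) (Function.leftLim η.toFun s)}

theorem smallOsc_anti (t a : ℝ≥0) {δ δ' : ℝ} (h : δ ≤ δ') :
    smallOsc E t a δ' ⊆ smallOsc E t a δ :=
  fun _ hη w v hw hv => hη w v (hw.trans h) (hv.trans h)

/-- A nearby path `η` follows `ω` with the role of `t` taken over by `s = lam t`. If `s = t`, the
two sides match. If `s ≠ t`, either `η` jumps by more than `a` at `s`, or the jump of `ω` at `t` was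
itself small, and then the misplacement of `s` costs little. -/
theorem exists_smallOsc_union_jumpNear_mem_nhds {t a : ℝ≥0} (ht : 0 < t) (ha : 0 < a) {δ₀ : ℝ}
    (hδ₀ : 0 < δ₀) (ω : SkorokhodSpace E) :
    ∃ δ : ℝ, 0 < δ ∧ smallOsc E t a δ ∪ jumpNear E t a δ₀ ∈ 𝓝 ω := by
  have ha' : (0 : ℝ) < a := by exact_mod_cast ha
  set l := Function.leftLim ω.toFun t
  obtain ⟨δ₁, hδ₁, h1⟩ := Metric.tendsto_nhdsWithin_nhds.1 (ω.isCadlag.tendsto_leftLim t)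
    (a / 8) (by positivity)
  obtain ⟨δ₂, hδ₂, h2⟩ := Metric.tendsto_nhdsWithin_nhds.1 (ω.isCadlag t).1
    (a / 8) (by positivity)
  set δ' := min δ₁ δ₂ with hδ'
  have hδ'pos : 0 < δ' := lt_min hδ₁ hδ₂
  set δ := min (δ' / 2) δ₀ with hδ
  have hδpos : 0 < δ := lt_min (by linarith) hδ₀
  have hδle : δ ≤ δ' / 2 := min_le_left _ _
  set ε := min ((a : ℝ) / 8) δ with hε
  have hεpos : 0 < ε := lt_min (by positivity) hδpos
  have hεa : ε ≤ a / 8 := min_le_left _ _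
  have hεδ : ε ≤ δ := min_le_right _ _
  set T : ℝ≥0 := t + δ'.toNNReal with hT
  have hTr : (T : ℝ) = t + δ' := by rw [hT, NNReal.coe_add, Real.coe_toNNReal _ hδ'pos.le]
  refine ⟨δ, hδpos, mem_of_superset (basicNhd_mem_nhds ω T hεpos) ?_⟩
  rintro η ⟨lam, hlam⟩
  have hnear : ∀ w, dist w t ≤ δ → ∃ w', lam w' = w ∧ dist w' t < δ' ∧
      dist (η w) (ω w') < a / 8 := by
    intro w hw
    refine ⟨lam.symm w, lam.apply_symm_apply w, ?_, ?_⟩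
    all_goals
      have hwT : lam.symm w ≤ T := by
        rw [OrderIso.symm_apply_le, ← NNReal.coe_le_coe]
        have h3 := (hlam T le_rfl).1
        rw [NNReal.dist_eq, abs_lt] at h3
        rw [NNReal.dist_eq, abs_le] at hw
        linarith [h3.1, hw.2]
      have h4 := hlam _ hwT
      rw [lam.apply_symm_apply] at h4
    · have := dist_triangle_left (lam.symm w) t w
      linarith [h4.1]
    · linarith [h4.2]
  have hright : ∀ w, dist w t ≤ δ → lam t ≤ w → dist (η w) (ω t) < a / 4 := by
    intro w hw htw
    obtain ⟨w', rfl, h3, h4⟩ := hnear w hw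
    have := h2 (lam.le_iff_le.1 htw : w' ∈ Ici t) (h3.trans_le (min_le_right _ _))
    linarith [dist_triangle (η (lam w')) (ω w') (ω t)]
  have hleft : ∀ w, dist w t ≤ δ → w < lam t → dist (η w) l < a / 4 := by
    intro w hw htw
    obtain ⟨w', rfl, h3, h4⟩ := hnear w hw
    have := h1 (lam.lt_iff_lt.1 htw : w' ∈ Iio t) (h3.trans_le (min_le_left _ _))
    linarith [dist_triangle (η (lam w')) (ω w') l]
  set s := lam t with hs
  have htT : t ≤ T := le_add_of_nonneg_right zero_le
  have hst : dist s t < ε := (hlam t htT).1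
  rcases eq_or_ne s t with hst' | hst'
  · refine Or.inl fun w v hw hv hwv => ?_
    by_cases htw : t ≤ w
    · have h3 := hright w hw (hst'.le.trans htw)
      have h4 := hright v hv (hst'.le.trans (hwv.1 htw))
      linarith [dist_triangle_right (η w) (η v) (ω t)]
    · have h3 := hleft w hw ((not_le.1 htw).trans_le hst'.ge)
      have h4 := hleft v hv ((not_le.1 fun h => htw (hwv.2 h)).trans_le hst'.ge)
      linarith [dist_triangle_right (η w) (η v) l]
  by_cases hjump : a < nndist (η s) (Function.leftLim η.toFun s)
  · exact Or.inr ⟨s, hst', hst.le.trans (hεδ.trans (min_le_right _ _)), hjump⟩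
  refine Or.inl fun w v hw hv _ => ?_
  have hs0 : 0 < s := zero_le.trans_lt (lam.lt_iff_lt.2 ht)
  have : (𝓝[<] s).NeBot := nhdsLT_neBot_of_exists_lt ⟨0, hs0⟩
  have hl : dist (Function.leftLim η.toFun s) l ≤ a / 4 := by
    refine le_of_tendsto ((η.isCadlag.tendsto_leftLim s).dist tendsto_const_nhds) ?_
    have h3 : ∀ᶠ w in 𝓝[<] s, dist w t < δ := mem_nhdsWithin_of_mem_nhds
      ((continuous_id.dist continuous_const).tendsto s |>.eventually
        (gt_mem_nhds (hst.trans_le hεδ)))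
    filter_upwards [h3, self_mem_nhdsWithin] with w hw hws
    exact (hleft w hw.le hws).le
  -- The left limit of `η` at `s` is within `a / 4` of `l` and `η s` is within `a / 4` of `ω t`, so
  -- a jump of `η` at most `a` bounds that of `ω` by `3 / 2 * a`. Crossing `s` then costs at most `a
  -- / 4 + 3 / 2 * a + a / 4 = 2 * a`.
  have hlt : dist l (ω t) ≤ 3 / 2 * a := by
    have h3 := hright s (hst.le.trans hεδ) le_rfl
    have h4 : dist (η s) (Function.leftLim η.toFun s) ≤ a := by
      rw [not_lt, ← NNReal.coe_le_coe, coe_nndist] at hjump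
      exact hjump
    have h5 := dist_triangle_left l (ω t) (η s)
    linarith [dist_triangle (η s) (Function.leftLim η.toFun s) l]
  rcases le_or_gt s w with h3 | h3 <;> rcases le_or_gt s v with h4 | h4
  · linarith [hright w hw h3, hright v hv h4, dist_triangle_right (η w) (η v) (ω t)]
  · linarith [hright w hw h3, hleft v hv h4, dist_triangle4_right (η w) (η v) (ω t) l,
      dist_comm l (ω t)]
  · linarith [hleft w hw h3, hright v hv h4, dist_triangle4_right (η w) (η v) l (ω t)]
  · linarith [hleft w hw h3, hleft v hv h4, dist_triangle_right (η w) (η v) l]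

theorem continuousAt_eval {ω : SkorokhodSpace E} {s : ℝ≥0}
    (h : Function.leftLim ω.toFun s = ω s) : ContinuousAt (fun η : SkorokhodSpace E => η s) ω := by
  refine Metric.tendsto_nhds.2 fun ε hε => ?_
  obtain ⟨δ, hδ, h1⟩ := Metric.continuousAt_iff.1 (ω.isCadlag.continuousAt h) (ε / 2) (by positivity)
  set e := min (ε / 2) (min δ 1)
  have he : 0 < e := lt_min (by positivity) (lt_min hδ one_pos)
  filter_upwards [basicNhd_mem_nhds ω (s + 1) he] with η hη
  obtain ⟨lam, hlam⟩ := mem_basicNhd_symm ((min_le_right _ _).trans (min_le_right _ _)) hη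
  obtain ⟨h2, h3⟩ := hlam s le_rfl
  have h4 := h1 (h2.trans_le ((min_le_right _ _).trans (min_le_left _ _)))
  have h5 : e ≤ ε / 2 := min_le_left _ _
  linarith [dist_triangle_left (η s) (ω s) (ω (lam s))]

end SkorokhodSpace

/-! ### Smoothing of one-sided evaluations by averaging in time -/

/-- The point at distance `w` from `t`, to the right (`b = true`) or to the left. -/
def approach (b : Bool) (t w : ℝ≥0) : ℝ≥0 := bif b then t + w else t - w

/-- The value (`b = true`) or the left limit of a path at `t`. -/
noncomputable def sideValue {E : Type*} [TopologicalSpace E] (b : Bool) (t : ℝ≥0) (ω : ℝ≥0 → E) :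
    E :=
  bif b then ω t else Function.leftLim ω t

theorem continuous_approach (b : Bool) (t : ℝ≥0) : Continuous (approach b t) := by
  cases b
  · exact continuous_const.sub continuous_id
  · exact continuous_const.add continuous_id

theorem dist_approach_le (b : Bool) (t w : ℝ≥0) : dist (approach b t w) t ≤ w := by
  cases b
  · change dist (t - w) t ≤ w
    rw [NNReal.dist_eq, abs_sub_comm, abs_of_nonneg (by simp)]
    rw [sub_le_iff_le_add', ← NNReal.coe_add, NNReal.coe_le_coe]
    exact le_tsub_add
  · change dist (t + w) t ≤ w
    simp [NNReal.dist_eq]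

theorem le_approach_iff (b : Bool) {t w : ℝ≥0} (ht : 0 < t) (hw : 0 < w) :
    t ≤ approach b t w ↔ b = true := by
  cases b
  · simpa [approach] using tsub_lt_self ht hw
  · simp [approach]

/-- The map is injective except that truncated subtraction collapses large `w` to `0`, whence the
condition `0 ∉ J`. -/
theorem countable_preimage_approach {J : Set ℝ≥0} (hJ : J.Countable) (h0 : 0 ∉ J) (b : Bool)
    (t : ℝ≥0) {δ : ℝ≥0} (hδ : 0 < δ) : {w | approach b t (δ * w) ∈ J}.Countable := by
  refine countable_of_injective_of_countable_image (f := fun w => approach b t (δ * w)) ?_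
    (hJ.mono (by rintro _ ⟨w, hw, rfl⟩; exact hw))
  intro w hw v hv hwv
  suffices δ * w = δ * v from mul_left_cancel₀ hδ.ne' this
  cases b
  · have hpos : ∀ {u}, u ∈ {w | approach false t (δ * w) ∈ J} → δ * u ≤ t := by
      intro u hu
      by_contra! h
      exact h0 (by simpa [approach, tsub_eq_zero_of_le h.le] using hu)
    exact (tsub_right_inj (hpos hw) (hpos hv)).1 hwv
  · exact add_left_cancel hwv

namespace IsCadlag

variable {E : Type*} [MetricSpace E] {ω : ℝ≥0 → E}

theorem tendsto_approach (h : IsCadlag ω) (b : Bool) (t : ℝ≥0) :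
    Tendsto (fun w => ω (approach b t w)) (𝓝[>] 0) (𝓝 (sideValue b t ω)) := by
  have h1 : Tendsto (approach b t) (𝓝[>] 0) (𝓝 t) := by
    have := (continuous_approach b t).tendsto 0
    have h0 : approach b t 0 = t := by cases b <;> simp [approach]
    rw [h0] at this
    exact this.mono_left nhdsWithin_le_nhds
  cases b
  · rcases eq_or_ne t 0 with rfl | ht
    · simp [approach, sideValue, leftLim_zero]
    · refine (h.tendsto_leftLim t).comp (tendsto_nhdsWithin_iff.2 ⟨h1, ?_⟩)
      filter_upwards [self_mem_nhdsWithin] with w hw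
      exact tsub_lt_self (pos_iff_ne_zero.2 ht) hw
  · refine (h.tendsto_right t).comp (tendsto_nhdsWithin_iff.2 ⟨h1, ?_⟩)
    filter_upwards [self_mem_nhdsWithin] with w hw
    exact lt_add_of_pos_right t hw

end IsCadlag

theorem SkorokhodSpace.dist_sideValue_le {E : Type*} [MetricSpace E] {η : SkorokhodSpace E}
    {t a : ℝ≥0} {δ : ℝ} (ht : 0 < t) (hη : η ∈ smallOsc E t a δ) (b : Bool) {w : ℝ≥0} (hw : 0 < w)
    (hwδ : w ≤ δ) : dist (η (approach b t w)) (sideValue b t η.toFun) ≤ 2 * a := by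
  refine le_of_tendsto (tendsto_const_nhds.dist (η.isCadlag.tendsto_approach b t)) ?_
  have : ∀ᶠ v : ℝ≥0 in 𝓝[>] 0, v < w := mem_nhdsWithin_of_mem_nhds (gt_mem_nhds hw)
  filter_upwards [this, self_mem_nhdsWithin] with v hv hv0
  refine hη _ _ ((dist_approach_le b t w).trans hwδ)
    (((dist_approach_le b t v).trans (by exact_mod_cast hv.le)).trans hwδ) ?_
  rw [le_approach_iff b ht hw, le_approach_iff b ht hv0]

/-- The uniform distribution on `(0, 1]`. -/
noncomputable def unitUniform : Measure ℝ≥0 :=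
  (volume.restrict (Ioc (0 : ℝ) 1)).map Real.toNNReal

instance : IsProbabilityMeasure unitUniform := by
  have : IsProbabilityMeasure (volume.restrict (Ioc (0 : ℝ) 1)) := ⟨by simp⟩
  exact Measure.isProbabilityMeasure_map measurable_real_toNNReal.aemeasurable

theorem ae_unitUniform_pos_le : ∀ᵐ w ∂unitUniform, 0 < w ∧ w ≤ 1 := by
  have hm : MeasurableSet {w : ℝ≥0 | 0 < w ∧ w ≤ 1} := measurableSet_Ioc
  rw [unitUniform, ae_map_iff measurable_real_toNNReal.aemeasurable hm]
  filter_upwards [ae_restrict_mem measurableSet_Ioc] with w hw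
  exact ⟨Real.toNNReal_pos.2 hw.1, Real.toNNReal_le_one.2 hw.2⟩

theorem unitUniform_countable {J : Set ℝ≥0} (hJ : J.Countable) : unitUniform J = 0 := by
  rw [unitUniform, Measure.map_apply measurable_real_toNNReal hJ.measurableSet,
    Measure.restrict_apply (measurable_real_toNNReal hJ.measurableSet)]
  refine measure_mono_null (t := (fun x : ℝ≥0 => (x : ℝ)) '' J) ?_
    ((hJ.image _).measure_zero _)
  rintro x ⟨hx, hx'⟩
  exact ⟨_, hx, Real.coe_toNNReal x hx'.1.le⟩

section Smoothing

variable {E : Type*} [MetricSpace E] {ι : Type*}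

/-- The average of `G` over the values of a path at times near `t`. -/
noncomputable def smoothed (G : (ι → E) →ᵇ ℝ) (b : ι → Bool) (t : ι → ℝ≥0) (δ : ℝ≥0)
    (ω : SkorokhodSpace E) : ℝ :=
  ∫ w, G (fun i => ω (approach (b i) (t i) (δ * w))) ∂unitUniform

theorem abs_smoothed_le (G : (ι → E) →ᵇ ℝ) (b : ι → Bool) (t : ι → ℝ≥0) (δ : ℝ≥0)
    (ω : SkorokhodSpace E) : |smoothed G b t δ ω| ≤ ‖G‖ := by
  have := norm_integral_le_of_norm_le_const (μ := unitUniform)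
    (f := fun w => G (fun i => ω (approach (b i) (t i) (δ * w)))) (C := ‖G‖)
    (Eventually.of_forall fun w => G.norm_coe_le_norm _)
  rwa [probReal_univ, mul_one] at this

variable [SecondCountableTopology E] [MeasurableSpace E] [BorelSpace E] [Fintype ι]

theorem measurable_smoothed_integrand (G : (ι → E) →ᵇ ℝ) (b : ι → Bool) (t : ι → ℝ≥0) (δ : ℝ≥0)
    (ω : SkorokhodSpace E) :
    Measurable fun w => G (fun i => ω (approach (b i) (t i) (δ * w))) :=
  G.continuous.measurable.comp (measurable_pi_lambda _ fun _ => ω.isCadlag.measurable.comp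
    ((continuous_approach _ _).measurable.comp (measurable_const_mul δ)))

/-- Evaluation at a time is continuous at every path that does not jump there. A path has countably
many jumps, so for almost every `w` none of the sampled times is a jump time, and dominated
convergence applies. -/
theorem continuous_smoothed (G : (ι → E) →ᵇ ℝ) (b : ι → Bool) (t : ι → ℝ≥0) {δ : ℝ≥0}
    (hδ : 0 < δ) : Continuous (smoothed G b t δ) := by
  refine continuous_iff_continuousAt.2 fun ω => ?_
  refine continuousAt_of_dominated (bound := fun _ => ‖G‖)
    (Eventually.of_forall fun η => (measurable_smoothed_integrand G b t δ η).aestronglyMeasurable)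
    (Eventually.of_forall fun η => Eventually.of_forall fun w => G.norm_coe_le_norm _)
    (integrable_const _) ?_
  have h1 : ∀ i, ∀ᵐ w ∂unitUniform,
      Function.leftLim ω.toFun (approach (b i) (t i) (δ * w)) = ω (approach (b i) (t i) (δ * w)) :=
    fun _ => unitUniform_countable (countable_preimage_approach ω.isCadlag.countable_jumps
      (fun h => h (IsCadlag.leftLim_zero ω.toFun)) _ _ hδ)
  filter_upwards [ae_all_iff.2 h1] with w hw
  exact G.continuous.continuousAt.comp
    (continuousAt_pi.2 fun i => SkorokhodSpace.continuousAt_eval (hw i))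

theorem tendsto_smoothed (G : (ι → E) →ᵇ ℝ) (b : ι → Bool) (t : ι → ℝ≥0)
    (ω : SkorokhodSpace E) :
    Tendsto (fun m : ℕ => smoothed G b t (1 / ((m : ℝ≥0) + 1)) ω) atTop
      (𝓝 (G fun i => sideValue (b i) (t i) ω.toFun)) := by
  have h1 : ∀ᵐ w ∂unitUniform, Tendsto
      (fun m : ℕ => G (fun i => ω (approach (b i) (t i) (1 / ((m : ℝ≥0) + 1) * w)))) atTop
      (𝓝 (G fun i => sideValue (b i) (t i) ω.toFun)) := by
    filter_upwards [ae_unitUniform_pos_le] with w hw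
    refine (G.continuous.tendsto _).comp (tendsto_pi_nhds.2 fun i => ?_)
    refine (ω.isCadlag.tendsto_approach (b i) (t i)).comp (tendsto_nhdsWithin_iff.2 ⟨?_, ?_⟩)
    · simpa using (tendsto_one_div_add_atTop_nhds_zero_nat (𝕜 := ℝ≥0)).mul_const w
    · exact Eventually.of_forall fun m => mul_pos (by positivity) hw.1
  have := tendsto_integral_of_dominated_convergence (μ := unitUniform) (fun _ => ‖G‖)
    (fun m : ℕ => (measurable_smoothed_integrand G b t (1 / ((m : ℝ≥0) + 1)) ω).aestronglyMeasurable)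
    (integrable_const _)
    (fun m => Eventually.of_forall fun w => G.norm_coe_le_norm _) h1
  simpa [smoothed] using this

/-- The estimate does not depend on the path beyond its one-sided oscillation, so it applies
uniformly in `n`. -/
theorem abs_smoothed_sub_le {G : (ι → E) →ᵇ ℝ} {K : ℝ≥0} (hG : LipschitzWith K G) (b : ι → Bool)
    {t : ι → ℝ≥0} (ht : ∀ i, 0 < t i) {δ a : ℝ≥0} (hδ : 0 < δ) {ω : SkorokhodSpace E}
    (hω : ∀ i, ω ∈ SkorokhodSpace.smallOsc E (t i) a δ) :
    |smoothed G b t δ ω - G fun i => sideValue (b i) (t i) ω.toFun| ≤ K * (2 * a) := by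
  have h1 : smoothed G b t δ ω - G (fun i => sideValue (b i) (t i) ω.toFun) =
      ∫ w, (G (fun i => ω (approach (b i) (t i) (δ * w))) -
        G fun i => sideValue (b i) (t i) ω.toFun) ∂unitUniform := by
    rw [integral_sub _ (integrable_const _)]
    · simp [smoothed]
    · exact Integrable.of_bound (measurable_smoothed_integrand G b t δ ω).aestronglyMeasurable ‖G‖
        (Eventually.of_forall fun w => G.norm_coe_le_norm _)
  rw [h1]
  have := norm_integral_le_of_norm_le_const (μ := unitUniform)
    (f := fun w => G (fun i => ω (approach (b i) (t i) (δ * w))) -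
      G fun i => sideValue (b i) (t i) ω.toFun) (C := K * (2 * a)) (by
    filter_upwards [ae_unitUniform_pos_le] with w hw
    rw [← dist_eq_norm]
    refine (hG.dist_le_mul _ _).trans ?_
    gcongr
    refine (dist_pi_le_iff (by positivity)).2 fun i => ?_
    refine SkorokhodSpace.dist_sideValue_le (ht i) (hω i) (b i) (mul_pos hδ hw.1) ?_
    exact_mod_cast mul_le_of_le_one_right hδ.le hw.2)
  simpa using this

end Smoothing

theorem abs_integral_le_of_abs_le_off_set {Ω : Type*} [MeasurableSpace Ω] {P : Measure Ω}
    [IsProbabilityMeasure P] {h : Ω → ℝ} {A : Set Ω} {α β C : ℝ} (hα : 0 ≤ α) (hβ : 0 ≤ β)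
    (hC : ∀ ω, |h ω| ≤ C) (hA : ∀ ω, ω ∉ A → |h ω| ≤ α) (hPA : P A ≤ ENNReal.ofReal β) :
    |∫ ω, h ω ∂P| ≤ α + C * β := by
  have hC0 : 0 ≤ C := (abs_nonneg _).trans (hC P.nonempty_of_neZero.some)
  -- `A` is not assumed measurable, so it is replaced by a measurable hull of the same measure.
  set A' := toMeasurable P A
  have hA' : MeasurableSet A' := measurableSet_toMeasurable P A
  have hint : Integrable (A'.indicator fun _ => C) P := (integrable_const C).indicator hA'
  have h1 : |∫ ω, h ω ∂P| ≤ ∫ ω, (α + A'.indicator (fun _ => C) ω) ∂P := by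
    refine norm_integral_le_of_norm_le (f := h)
      (g := fun ω => α + A'.indicator (fun _ => C) ω) ((integrable_const α).add hint)
      (Eventually.of_forall fun ω => ?_)
    by_cases hω : ω ∈ A'
    · simpa [hω] using (hC ω).trans (le_add_of_nonneg_left hα)
    · simpa [hω] using hA ω fun h => hω (subset_toMeasurable P A h)
  refine h1.trans ?_
  rw [integral_add (integrable_const α) hint,
    integral_indicator_const _ hA', integral_const, probReal_univ, one_smul, smul_eq_mul, mul_comm]
  gcongr
  rw [Measure.real, measure_toMeasurable]
  exact ENNReal.toReal_le_of_le_ofReal hβ hPA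

/-! ### Convergence of the joint laws of values and left limits -/

section Convergence

variable {E : Type*} [MetricSpace E]
  {Ω : Type*} [MeasurableSpace Ω] {P : Measure Ω} [IsProbabilityMeasure P]
  {X : ℝ≥0 → Ω → E} {hXcad : ∀ ω, IsCadlag (fun t => X t ω)}
  {Ωn : ℕ → Type*} [∀ n, MeasurableSpace (Ωn n)] {Pn : ∀ n, Measure (Ωn n)}
  [∀ n, IsProbabilityMeasure (Pn n)]
  {Xn : ∀ n, ℝ≥0 → Ωn n → E}
  {hXncad : ∀ n ω, IsCadlag (fun t => Xn n t ω)}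

/-- Every path is interior to some union of `smallOsc` and `jumpNear`, so `Xⁿ` eventually lies in
one such union with high probability; then the improbable `jumpNear` is discarded. -/
theorem exists_eventually_measure_notMem_smallOsc_le
    (hconv : TendstoInDistribution (fun n => pathMap (Xn n) (hXncad n)) atTop
      (pathMap X hXcad) Pn P) {t a : ℝ≥0} (ht : 0 < t) (ha : 0 < a)
    (hjump : ∀ ε : ℝ≥0∞, 0 < ε → ∃ δ : ℝ, 0 < δ ∧ ∀ᶠ n in atTop,
      Pn n {ω | pathMap (Xn n) (hXncad n) ω ∈ SkorokhodSpace.jumpNear E t a δ} ≤ ε)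
    {ε : ℝ≥0∞} (hε : 0 < ε) :
    ∃ δ : ℝ, 0 < δ ∧ ∀ᶠ n in atTop,
      Pn n {ω | pathMap (Xn n) (hXncad n) ω ∉ SkorokhodSpace.smallOsc E t a δ} ≤ ε := by
  have hε2 : 0 < ε / 2 := ENNReal.half_pos hε.ne'
  obtain ⟨δ₀, hδ₀, h0⟩ := hjump _ hε2
  obtain ⟨k, hk⟩ := hconv.exists_eventually_measure_notMem_le
    (G := fun k : ℕ => SkorokhodSpace.smallOsc E t a (1 / ((k : ℝ) + 1)) ∪
      SkorokhodSpace.jumpNear E t a δ₀)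
    (fun i j hij => union_subset_union_left _ (SkorokhodSpace.smallOsc_anti t a
      (one_div_le_one_div_of_le (by positivity) (by gcongr))))
    (fun ω => by
      obtain ⟨δ, hδ, h⟩ :=
        SkorokhodSpace.exists_smallOsc_union_jumpNear_mem_nhds ht ha hδ₀ ω
      obtain ⟨k, hk⟩ := exists_nat_one_div_lt hδ
      exact ⟨k, mem_of_superset h (union_subset_union_left _
        (SkorokhodSpace.smallOsc_anti t a hk.le))⟩) hε2
  refine ⟨1 / ((k : ℝ) + 1), by positivity, ?_⟩
  filter_upwards [h0, hk] with n hn1 hn2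
  refine (measure_mono fun ω hω => ?_).trans ((measure_union_le _ _).trans
    ((add_le_add hn1 hn2).trans (ENNReal.add_halves ε).le))
  by_cases h : pathMap (Xn n) (hXncad n) ω ∈ SkorokhodSpace.jumpNear E t a δ₀
  · exact Or.inl h
  · exact Or.inr fun h' => h'.elim hω h

variable [MeasurableSpace E] [BorelSpace E]

theorem measurable_sideValue {X : ℝ≥0 → Ω → E} (hX : ∀ t, Measurable (X t))
    (hc : ∀ ω, IsCadlag fun t => X t ω) (b : Bool) (t : ℝ≥0) :
    Measurable fun ω => sideValue b t fun v => X v ω := by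
  cases b
  · exact measurable_leftLim hX hc t
  · exact hX t

variable [SecondCountableTopology E]

/-- If oscillations of `Xⁿ` on either side of each `t > 0` are uniformly small, then the
finite-dimensional distributions of values and left limits at positive times converge. -/
theorem tendsto_integral_sideValue
    (hconv : TendstoInDistribution (fun n => pathMap (Xn n) (hXncad n)) atTop
      (pathMap X hXcad) Pn P) (hX : ∀ t, Measurable (X t)) (hXn : ∀ n t, Measurable (Xn n t))
    (hosc : ∀ t a : ℝ≥0, 0 < t → 0 < a → ∀ ε : ℝ≥0∞, 0 < ε → ∃ δ : ℝ, 0 < δ ∧ ∀ᶠ n in atTop,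
      Pn n {ω | pathMap (Xn n) (hXncad n) ω ∉ SkorokhodSpace.smallOsc E t a δ} ≤ ε)
    {ι : Type*} [Fintype ι] (b : ι → Bool) {t : ι → ℝ≥0} (ht : ∀ i, 0 < t i)
    (G : (ι → E) →ᵇ ℝ) :
    Tendsto (fun n => ∫ ω, G (fun i => sideValue (b i) (t i) fun v => Xn n v ω) ∂(Pn n)) atTop
      (𝓝 (∫ ω, G (fun i => sideValue (b i) (t i) fun v => X v ω) ∂P)) := by
  have hm : Measurable fun ω i => sideValue (b i) (t i) fun v => X v ω :=
    measurable_pi_lambda _ fun i => measurable_sideValue hX hXcad _ _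
  have hmn : ∀ n, Measurable fun ω i => sideValue (b i) (t i) fun v => Xn n v ω := fun n =>
    measurable_pi_lambda _ fun i => measurable_sideValue (hXn n) (hXncad n) _ _
  have key : ∀ (G : (ι → E) →ᵇ ℝ) (K : ℝ≥0), LipschitzWith K G →
      Tendsto (fun n => ∫ ω, G (fun i => sideValue (b i) (t i) fun v => Xn n v ω) ∂(Pn n)) atTop
      (𝓝 (∫ ω, G (fun i => sideValue (b i) (t i) fun v => X v ω) ∂P)) := by
    intro G K hK
    refine Metric.tendsto_nhds.2 fun e he => ?_
    -- There are four errors of size `e / 4`: oscillation on the good event (`a`), the exceptional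
    -- event (`β`), smoothing for `X` (`m`), and weak convergence of the smoothed functional (`n`).
    -- The width `d` is fixed before `n`.
    obtain ⟨a, ha, haK⟩ : ∃ a : ℝ≥0, 0 < a ∧ K * (2 * a) ≤ e / 4 := by
      refine ⟨Real.toNNReal (e / 8 / (K + 1)), Real.toNNReal_pos.2 (by positivity), ?_⟩
      rw [Real.coe_toNNReal _ (by positivity)]
      have h1 : (K : ℝ) / (K + 1) ≤ 1 := by rw [div_le_one (by positivity)]; linarith
      calc (K : ℝ) * (2 * (e / 8 / (K + 1))) = K / (K + 1) * (e / 4) := by field_simp; ring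
        _ ≤ 1 * (e / 4) := by gcongr
        _ = e / 4 := one_mul _
    obtain ⟨β, hβ, hβG⟩ : ∃ β : ℝ, 0 < β ∧ 2 * ‖G‖ * (Fintype.card ι * β) ≤ e / 4 := by
      refine ⟨e / 4 / (2 * ‖G‖ * Fintype.card ι + 1), by positivity, ?_⟩
      have h1 : (2 * ‖G‖ * Fintype.card ι) / (2 * ‖G‖ * Fintype.card ι + 1) ≤ 1 := by
        rw [div_le_one (by positivity)]; linarith
      calc 2 * ‖G‖ * (Fintype.card ι * (e / 4 / (2 * ‖G‖ * Fintype.card ι + 1)))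
          = (2 * ‖G‖ * Fintype.card ι) / (2 * ‖G‖ * Fintype.card ι + 1) * (e / 4) := by ring
        _ ≤ 1 * (e / 4) := by gcongr
        _ = e / 4 := one_mul _
    choose δ hδ hδn using fun i => hosc (t i) a (ht i) ha (ENNReal.ofReal β)
      (ENNReal.ofReal_pos.2 hβ)
    have hlimX : Tendsto (fun m : ℕ => ∫ ω, smoothed G b t (1 / ((m : ℝ≥0) + 1))
        (pathMap X hXcad ω) ∂P) atTop
        (𝓝 (∫ ω, G (fun i => sideValue (b i) (t i) fun v => X v ω) ∂P)) :=
      tendsto_integral_of_dominated_convergence (fun _ => ‖G‖)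
        (fun m => ((continuous_smoothed G b t (by positivity)).measurable.comp_aemeasurable
          hconv.aemeasurable_limit).aestronglyMeasurable) (integrable_const _)
        (fun m => Eventually.of_forall fun ω => abs_smoothed_le G b t _ _)
        (Eventually.of_forall fun ω => tendsto_smoothed G b t (pathMap X hXcad ω))
    have hsmall : ∀ᶠ m : ℕ in atTop, ∀ i, (1 : ℝ) / ((m : ℝ) + 1) ≤ δ i :=
      eventually_all.2 fun i =>
        (tendsto_one_div_add_atTop_nhds_zero_nat.eventually (gt_mem_nhds (hδ i))).mono
          fun m hm => le_of_lt hm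
    obtain ⟨m, hm1, hm2⟩ :=
      ((Metric.tendsto_nhds.1 hlimX (e / 4) (by positivity)).and hsmall).exists
    set d : ℝ≥0 := 1 / ((m : ℝ≥0) + 1) with hd
    have hd0 : 0 < d := by positivity
    have hdr : (d : ℝ) = 1 / ((m : ℝ) + 1) := by rw [hd]; push_cast; rfl
    set F : SkorokhodSpace E →ᵇ ℝ := BoundedContinuousFunction.ofNormedAddCommGroup
      (smoothed G b t d) (continuous_smoothed G b t hd0) ‖G‖ (abs_smoothed_le G b t d)
    have hlimn : Tendsto (fun n => ∫ ω, smoothed G b t d (pathMap (Xn n) (hXncad n) ω) ∂(Pn n))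
        atTop (𝓝 (∫ ω, smoothed G b t d (pathMap X hXcad ω) ∂P)) := by
      have h1 := ProbabilityMeasure.tendsto_iff_forall_integral_tendsto.1 hconv.tendsto F
      have h2 : ∀ n, ∫ η, F η ∂((Pn n).map (pathMap (Xn n) (hXncad n))) =
          ∫ ω, smoothed G b t d (pathMap (Xn n) (hXncad n) ω) ∂(Pn n) := fun n =>
        integral_map (hconv.forall_aemeasurable n) F.continuous.measurable.aestronglyMeasurable
      have h3 : ∫ η, F η ∂(P.map (pathMap X hXcad)) =
          ∫ ω, smoothed G b t d (pathMap X hXcad ω) ∂P :=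
        integral_map hconv.aemeasurable_limit F.continuous.measurable.aestronglyMeasurable
      rw [← h3]
      refine h1.congr fun n => ?_
      exact h2 n
    filter_upwards [eventually_all.2 hδn, Metric.tendsto_nhds.1 hlimn (e / 4) (by positivity)]
      with n hn1 hn2
    have hdiff : |∫ ω, (smoothed G b t d (pathMap (Xn n) (hXncad n) ω) -
        G fun i => sideValue (b i) (t i) fun v => Xn n v ω) ∂(Pn n)| ≤
        K * (2 * a) + 2 * ‖G‖ * (Fintype.card ι * β) := by
      refine abs_integral_le_of_abs_le_off_set (A := ⋃ i, {ω | pathMap (Xn n) (hXncad n) ω ∉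
        SkorokhodSpace.smallOsc E (t i) a (δ i)}) (by positivity) (by positivity)
        (fun ω => ?_) (fun ω hω => ?_) ?_
      · have h1 := abs_smoothed_le G b t d (pathMap (Xn n) (hXncad n) ω)
        have h2 := G.norm_coe_le_norm fun i => sideValue (b i) (t i) fun v => Xn n v ω
        rw [Real.norm_eq_abs] at h2
        linarith [abs_sub (smoothed G b t d (pathMap (Xn n) (hXncad n) ω))
          (G fun i => sideValue (b i) (t i) fun v => Xn n v ω)]
      · simp only [mem_iUnion, mem_ofPred_eq, not_exists, not_not] at hω
        refine abs_smoothed_sub_le hK b ht hd0 (ω := pathMap (Xn n) (hXncad n) ω) fun i => ?_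
        exact SkorokhodSpace.smallOsc_anti (t i) a (hdr.le.trans (hm2 i)) (hω i)
      · refine (measure_iUnion_fintype_le _ _).trans ((Finset.sum_le_sum fun i _ => hn1 i).trans ?_)
        rw [Finset.sum_const, Finset.card_univ, ENNReal.ofReal_mul (by positivity),
          ENNReal.ofReal_natCast, nsmul_eq_mul]
    rw [integral_sub] at hdiff
    · rw [Real.dist_eq] at hm1 hn2 ⊢
      rw [abs_lt] at hm1 hn2 ⊢
      rw [abs_le] at hdiff
      constructor <;> linarith [hm1.1, hm1.2, hn2.1, hn2.2, hdiff.1, hdiff.2]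
    · exact Integrable.of_bound (((continuous_smoothed G b t hd0).measurable.comp_aemeasurable
        (hconv.forall_aemeasurable n)).aestronglyMeasurable) ‖G‖
        (Eventually.of_forall fun ω => abs_smoothed_le G b t _ _)
    · exact Integrable.of_bound (G.continuous.measurable.comp (hmn n)).aestronglyMeasurable ‖G‖
        (Eventually.of_forall fun ω => G.norm_coe_le_norm _)
  -- Lipschitz test functions already determine weak convergence on `ι → E`, which yields all
  -- bounded continuous `G`.
  have hweak : Tendsto (β := ProbabilityMeasure (ι → E)) (fun n =>
      ⟨(Pn n).map fun ω i => sideValue (b i) (t i) fun v => Xn n v ω,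
        Measure.isProbabilityMeasure_map (hmn n).aemeasurable⟩) atTop
      (𝓝 ⟨P.map fun ω i => sideValue (b i) (t i) fun v => X v ω,
        Measure.isProbabilityMeasure_map hm.aemeasurable⟩) := by
    refine tendsto_iff_forall_lipschitz_integral_tendsto.2 fun f hf hL => ?_
    obtain ⟨K, hK⟩ := hL
    obtain ⟨C, hC⟩ := hf
    have h1 := key (.mkOfBound ⟨f, hK.continuous⟩ C hC) K hK
    change Tendsto (fun n => ∫ x, f x ∂((Pn n).map fun ω i => sideValue (b i) (t i) fun v => Xn n v ω))
      atTop (𝓝 (∫ x, f x ∂(P.map fun ω i => sideValue (b i) (t i) fun v => X v ω)))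
    rw [integral_map hm.aemeasurable hK.continuous.measurable.aestronglyMeasurable]
    refine h1.congr fun n => ?_
    rw [integral_map (hmn n).aemeasurable hK.continuous.measurable.aestronglyMeasurable]
    rfl
  have h1 := ProbabilityMeasure.tendsto_iff_forall_integral_tendsto.1 hweak G
  change Tendsto (fun n => ∫ x, G x ∂((Pn n).map fun ω i => sideValue (b i) (t i) fun v => Xn n v ω))
      atTop (𝓝 (∫ x, G x ∂(P.map fun ω i => sideValue (b i) (t i) fun v => X v ω))) at h1
  rw [integral_map hm.aemeasurable G.continuous.measurable.aestronglyMeasurable] at h1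
  refine h1.congr fun n => ?_
  rw [integral_map (hmn n).aemeasurable G.continuous.measurable.aestronglyMeasurable]

end Convergence

/-! ### Test products and Fubini for the drift -/

theorem abs_prod_boundedContinuousFunction_le {E : Type*} [TopologicalSpace E] {k : ℕ}
    (h : Fin k → (E →ᵇ ℝ)) (x : Fin k → E) : |∏ i, h i (x i)| ≤ ∏ i, ‖h i‖ := by
  rw [Finset.abs_prod]
  exact Finset.prod_le_prod (fun _ _ => abs_nonneg _) fun i _ => (h i).norm_coe_le_norm _

instance isFiniteMeasure_restrict_Ioc (ν : Measure ℝ≥0) [IsLocallyFiniteMeasure ν] (s t : ℝ≥0) :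
    IsFiniteMeasure (ν.restrict (Ioc s t)) :=
  ⟨by simpa using measure_Ioc_lt_top⟩

section Drift

variable {E : Type*} [MetricSpace E] [MeasurableSpace E] [BorelSpace E]
  {Ω : Type*} {mΩ : MeasurableSpace Ω} {P : Measure Ω} [IsFiniteMeasure P]
  {X : ℝ≥0 → Ω → E}

theorem measurable_comp_uncurry_leftLim (hX : ∀ t, Measurable (X t))
    (hc : ∀ ω, IsCadlag fun t => X t ω) (g : E →ᵇ ℝ) :
    Measurable fun p : ℝ≥0 × Ω => g (Function.leftLim (fun v => X v p.2) p.1) :=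
  g.continuous.measurable.comp (measurable_uncurry_leftLim hX hc)

theorem integrable_comp_leftLim_path (hX : ∀ t, Measurable (X t))
    (hc : ∀ ω, IsCadlag fun t => X t ω) (g : E →ᵇ ℝ) (ν : Measure ℝ≥0) [IsFiniteMeasure ν]
    (ω : Ω) : Integrable (fun v => g (Function.leftLim (fun w => X w ω) v)) ν :=
  Integrable.of_bound ((measurable_comp_uncurry_leftLim hX hc g).comp
      measurable_prodMk_right).aestronglyMeasurable ‖g‖
    (Eventually.of_forall fun _ => g.norm_coe_le_norm _)

theorem stronglyMeasurable_drift (hX : ∀ t, Measurable (X t))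
    (hc : ∀ ω, IsCadlag fun t => X t ω) (g : E →ᵇ ℝ) (ν : Measure ℝ≥0) [IsFiniteMeasure ν] :
    StronglyMeasurable fun ω => ∫ v, g (Function.leftLim (fun w => X w ω) v) ∂ν :=
  (measurable_comp_uncurry_leftLim hX hc g).stronglyMeasurable.integral_prod_left'

theorem integrable_drift (hX : ∀ t, Measurable (X t))
    (hc : ∀ ω, IsCadlag fun t => X t ω) (g : E →ᵇ ℝ) (ν : Measure ℝ≥0) [IsFiniteMeasure ν] :
    Integrable (fun ω => ∫ v, g (Function.leftLim (fun w => X w ω) v) ∂ν) P :=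
  Integrable.integral_prod_right (f := fun p : ℝ≥0 × Ω => g (Function.leftLim (fun w => X w p.2) p.1))
    (Integrable.of_bound (measurable_comp_uncurry_leftLim hX hc g).aestronglyMeasurable ‖g‖
      (Eventually.of_forall fun _ => g.norm_coe_le_norm _))

theorem integrable_comp_leftLim_mul (hX : ∀ t, Measurable (X t))
    (hc : ∀ ω, IsCadlag fun t => X t ω) (g : E →ᵇ ℝ) (ν : Measure ℝ≥0) [IsFiniteMeasure ν]
    {H : Ω → ℝ} (hH : Measurable H) {C : ℝ} (hC : ∀ ω, |H ω| ≤ C) :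
    Integrable (fun p : ℝ≥0 × Ω => g (Function.leftLim (fun w => X w p.2) p.1) * H p.2)
      (ν.prod P) := by
  refine Integrable.of_bound ((measurable_comp_uncurry_leftLim hX hc g).mul
    (hH.comp measurable_snd)).aestronglyMeasurable (‖g‖ * C) (Eventually.of_forall fun p => ?_)
  rw [norm_mul]
  exact mul_le_mul (g.norm_coe_le_norm _) (hC _) (norm_nonneg _) (norm_nonneg _)

/-- Reduces the drift to expectations involving the left limit at one fixed time `v`. -/
theorem integral_drift_mul (hX : ∀ t, Measurable (X t))
    (hc : ∀ ω, IsCadlag fun t => X t ω) (g : E →ᵇ ℝ) (ν : Measure ℝ≥0) [IsFiniteMeasure ν]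
    {H : Ω → ℝ} (hH : Measurable H) {C : ℝ} (hC : ∀ ω, |H ω| ≤ C) :
    ∫ ω, (∫ v, g (Function.leftLim (fun w => X w ω) v) ∂ν) * H ω ∂P =
      ∫ v, ∫ ω, g (Function.leftLim (fun w => X w ω) v) * H ω ∂P ∂ν := by
  rw [integral_integral_swap (integrable_comp_leftLim_mul hX hc g ν hH hC)]
  simp_rw [integral_mul_const]

end Drift

/-! ### Integrability and error decomposition for approximating pairs -/

section ApproximatingPair

theorem MeasureTheory.Filtration.predictable_le {Ω : Type*} {mΩ : MeasurableSpace Ω}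
    (𝓕 : Filtration ℝ≥0 mΩ) : 𝓕.predictable ≤ Prod.instMeasurableSpace := by
  refine MeasurableSpace.generateFrom_le ?_
  rintro _ (⟨A, hA, rfl⟩ | ⟨i, A, hA, rfl⟩)
  · exact (measurableSet_singleton _).prod (𝓕.le _ _ hA)
  · exact measurableSet_Ioi.prod (𝓕.le _ _ hA)

namespace IsApproximatingPair

variable {Ω : Type*} {mΩ : MeasurableSpace Ω} {𝓕 : Filtration ℝ≥0 mΩ} {P : Measure Ω}
  {q : Measure ℝ≥0} {ξ φ : ℝ≥0 → Ω → ℝ}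

theorem integrable_fst (h : IsApproximatingPair 𝓕 P q ξ φ) {t : ℝ≥0} (ht : 0 < t) :
    Integrable (ξ t) P := by
  refine ⟨((h.predictable_fst.stronglyAdapted t).mono (𝓕.le t)).aestronglyMeasurable,
    lt_of_le_of_lt ?_ (h.bounded t ht)⟩
  refine le_trans (lintegral_mono fun ω => le_self_add) (le_iSup₂_of_le t le_rfl le_rfl)

variable [IsProbabilityMeasure P]

/-- The `L¹` bound is uniform on compact time intervals, so it integrates against any locally finite
`ν`; both the measure of the pair and the limiting one are needed. -/
theorem integrable_snd (h : IsApproximatingPair 𝓕 P q ξ φ) (s : ℝ≥0) {t : ℝ≥0} (ht : 0 < t)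
    (ν : Measure ℝ≥0) [IsLocallyFiniteMeasure ν] :
    Integrable (fun p : ℝ≥0 × Ω => φ p.1 p.2) ((ν.restrict (Ioc s t)).prod P) := by
  have hm : StronglyMeasurable (fun p : ℝ≥0 × Ω => φ p.1 p.2) :=
    h.predictable_snd.mono 𝓕.predictable_le
  refine ⟨hm.aestronglyMeasurable, ?_⟩
  rw [HasFiniteIntegral, lintegral_prod _ hm.enorm.aemeasurable]
  set C := ⨆ s ≤ t, ∫⁻ ω, (‖ξ s ω‖ₑ + ‖φ s ω‖ₑ) ∂P
  calc ∫⁻ v in Ioc s t, ∫⁻ ω, ‖φ v ω‖ₑ ∂P ∂ν ≤ ∫⁻ _ in Ioc s t, C ∂ν := by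
        refine setLIntegral_mono measurable_const fun v hv => ?_
        exact le_trans (lintegral_mono fun ω => le_add_self) (le_iSup₂_of_le v hv.2 le_rfl)
    _ = C * ν (Ioc s t) := setLIntegral_const _ _
    _ < ∞ := ENNReal.mul_lt_top (h.bounded t ht) measure_Ioc_lt_top

theorem ae_integrableOn_snd (h : IsApproximatingPair 𝓕 P q ξ φ) (t : ℝ≥0)
    (ν : Measure ℝ≥0) [IsLocallyFiniteMeasure ν] :
    ∀ᵐ ω ∂P, IntegrableOn (fun v => φ v ω) (Ioc 0 t) ν := by
  rcases eq_or_ne t 0 with rfl | ht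
  · simp
  · exact (h.integrable_snd 0 (pos_iff_ne_zero.2 ht) ν).prod_left_ae

theorem integrable_setIntegral_snd (h : IsApproximatingPair 𝓕 P q ξ φ) {s t : ℝ≥0} (hst : s < t)
    (ν : Measure ℝ≥0) [IsLocallyFiniteMeasure ν] :
    Integrable (fun ω => ∫ v in Ioc s t, φ v ω ∂ν) P := by
  exact (h.integrable_snd s (zero_le.trans_lt hst) ν).integral_prod_right

/-- The martingale property against bounded `𝓕 s`-measurable test variables. -/
theorem integral_increment_mul_eq_zero [IsLocallyFiniteMeasure q]
    (h : IsApproximatingPair 𝓕 P q ξ φ) {s t : ℝ≥0} (hst : s < t)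
    {H : Ω → ℝ} (hH : StronglyMeasurable[𝓕 s] H) {C : ℝ} (hC : ∀ ω, |H ω| ≤ C) :
    ∫ ω, (ξ t ω - ξ s ω - ∫ v in Ioc s t, φ v ω ∂q) * H ω ∂P = 0 := by
  set N : ℝ≥0 → Ω → ℝ := fun t ω => ξ t ω - ∫ s in Ioc 0 t, φ s ω ∂q with hN
  have hNt : Integrable (N t) P := h.martingale.integrable t
  have hNs : Integrable (N s) P := h.martingale.integrable s
  have hHm : AEStronglyMeasurable H P := (hH.mono (𝓕.le s)).aestronglyMeasurable
  have hbd : ∀ᵐ ω ∂P, ‖H ω‖ ≤ C := Eventually.of_forall hC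
  have h1 : ∫ ω, H ω * N t ω ∂P = ∫ ω, H ω * N s ω ∂P := by
    have h2 := condExp_stronglyMeasurable_mul_of_bound (𝓕.le s) hH hNt C hbd
    have h3 := h.martingale.condExp_ae_eq hst.le
    calc ∫ ω, H ω * N t ω ∂P = ∫ ω, (P[H * N t | 𝓕 s]) ω ∂P := (integral_condExp (𝓕.le s)).symm
      _ = ∫ ω, H ω * N s ω ∂P := by
        refine integral_congr_ae ?_
        filter_upwards [h2, h3] with ω h2 h3
        rw [h2, Pi.mul_apply, h3]
  have h4 : ∀ᵐ ω ∂P, (ξ t ω - ξ s ω - ∫ v in Ioc s t, φ v ω ∂q) * H ω =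
      H ω * N t ω - H ω * N s ω := by
    filter_upwards [h.ae_integrableOn_snd t q] with ω hω
    have h5 : ∫ v in Ioc 0 t, φ v ω ∂q =
        ∫ v in Ioc 0 s, φ v ω ∂q + ∫ v in Ioc s t, φ v ω ∂q := by
      rw [← setIntegral_union (Ioc_disjoint_Ioc_of_le le_rfl) measurableSet_Ioc
        (hω.mono_set (Ioc_subset_Ioc_right hst.le)) (hω.mono_set (Ioc_subset_Ioc_left zero_le)),
        Ioc_union_Ioc_eq_Ioc zero_le hst.le]
    simp only [hN, h5]
    ring
  rw [integral_congr_ae h4, integral_sub (hNt.bdd_mul hHm hbd) (hNs.bdd_mul hHm hbd), h1, sub_self]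

variable {E : Type*} [MetricSpace E] [MeasurableSpace E] [BorelSpace E]

/-- Subtract the vanishing martingale increment and replace `ξ` by `f (X)` at both ends, `q` by `ν`,
and `φ` by `g`. In the application `q` is the approximating measure and `ν` the limiting one. -/
theorem integral_test_increment_mul_eq [IsLocallyFiniteMeasure q]
    (h : IsApproximatingPair 𝓕 P q ξ φ) {X : ℝ≥0 → Ω → E} (hX : ∀ t, Measurable (X t))
    (hc : ∀ ω, IsCadlag fun t => X t ω) (f g : E →ᵇ ℝ) (ν : Measure ℝ≥0)
    [IsLocallyFiniteMeasure ν] {s t : ℝ≥0} (hs : 0 < s) (hst : s < t)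
    {H : Ω → ℝ} (hH : StronglyMeasurable[𝓕 s] H) {C : ℝ} (hC : ∀ ω, |H ω| ≤ C) :
    ∫ ω, (f (X t ω) - f (X s ω) -
        ∫ v in Ioc s t, g (Function.leftLim (fun w => X w ω) v) ∂ν) * H ω ∂P =
      ∫ ω, (ξ s ω - f (X s ω)) * H ω ∂P - ∫ ω, (ξ t ω - f (X t ω)) * H ω ∂P +
      ∫ ω, ((∫ v in Ioc s t, φ v ω ∂q) - ∫ v in Ioc s t, φ v ω ∂ν) * H ω ∂P +
      ∫ ω, (∫ v in Ioc s t, (φ v ω - g (Function.leftLim (fun w => X w ω) v)) ∂ν) * H ω ∂P := by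
  have hHm : AEStronglyMeasurable H P := (hH.mono (𝓕.le s)).aestronglyMeasurable
  have hbd : ∀ᵐ ω ∂P, ‖H ω‖ ≤ C := Eventually.of_forall hC
  have hmul : ∀ {Y : Ω → ℝ}, Integrable Y P → Integrable (fun ω => Y ω * H ω) P :=
    fun hY => hY.mul_bdd hHm hbd
  have hf : ∀ u, Integrable (fun ω => f (X u ω)) P := fun u =>
    Integrable.of_bound (f.continuous.measurable.comp (hX u)).aestronglyMeasurable ‖f‖
      (Eventually.of_forall fun _ => f.norm_coe_le_norm _)
  have hξt := h.integrable_fst (hs.trans hst)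
  have hξs := h.integrable_fst hs
  have hφq := h.integrable_setIntegral_snd hst q
  have hφν := h.integrable_setIntegral_snd hst ν
  have hg : Integrable (fun ω => ∫ v in Ioc s t, g (Function.leftLim (fun w => X w ω) v) ∂ν) P :=
    integrable_drift hX hc g _
  have h1 := h.integral_increment_mul_eq_zero hst hH hC
  have h2 : ∫ ω, (∫ v in Ioc s t, (φ v ω - g (Function.leftLim (fun w => X w ω) v)) ∂ν) * H ω ∂P =
      ∫ ω, ((∫ v in Ioc s t, φ v ω ∂ν) -
        ∫ v in Ioc s t, g (Function.leftLim (fun w => X w ω) v) ∂ν) * H ω ∂P := by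
    refine integral_congr_ae ?_
    filter_upwards [h.ae_integrableOn_snd t ν] with ω hω
    rw [integral_sub (hω.mono_set (Ioc_subset_Ioc_left zero_le))
      (integrable_comp_leftLim_path hX hc g _ ω)]
  have hsub : ∀ {Y Z : Ω → ℝ}, Integrable Y P → Integrable Z P →
      ∫ ω, (Y ω - Z ω) * H ω ∂P = ∫ ω, Y ω * H ω ∂P - ∫ ω, Z ω * H ω ∂P := by
    intro Y Z hY hZ
    rw [← integral_sub (hmul hY) (hmul hZ)]
    simp_rw [sub_mul]
  have e1 := hsub ((hf t).sub (hf s)) hg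
  have e2 := hsub (hf t) (hf s)
  have e3 := hsub (hξt.sub hξs) hφq
  have e4 := hsub hξt hξs
  simp only [Pi.sub_apply] at e1 e3
  rw [h2, hsub hξs (hf s), hsub hξt (hf t), hsub hφq hφν, hsub hφν hg, e1, e2]
  rw [e3, e4] at h1
  linarith

end IsApproximatingPair

end ApproximatingPair

theorem measurable_prod_comp {E : Type*} [TopologicalSpace E] [MeasurableSpace E] [BorelSpace E]
    {Ω : Type*} {m : MeasurableSpace Ω} {X : ℝ≥0 → Ω → E} {k : ℕ}
    {τ : Fin k → ℝ≥0} (hX : ∀ i, Measurable (X (τ i))) (h : Fin k → (E →ᵇ ℝ)) :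
    Measurable fun ω => ∏ i, h i (X (τ i) ω) :=
  Finset.measurable_fun_prod _ fun i _ => (h i).continuous.measurable.comp (hX i)

/-! ### Convergence of the tested values and drifts -/

section Limit

variable {E : Type*} [MetricSpace E]
  {Ω : Type*} [MeasurableSpace Ω] {P : Measure Ω}
  {X : ℝ≥0 → Ω → E}
  {Ωn : ℕ → Type*} [∀ n, MeasurableSpace (Ωn n)] {Pn : ∀ n, Measure (Ωn n)}
  {Xn : ∀ n, ℝ≥0 → Ωn n → E}

theorem tendsto_integral_sideValue_mul_prod
    (hside : ∀ (m : ℕ) (b : Fin m → Bool) (t : Fin m → ℝ≥0), (∀ i, 0 < t i) →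
      ∀ G : (Fin m → E) →ᵇ ℝ, Tendsto
        (fun n => ∫ ω, G (fun i => sideValue (b i) (t i) fun v => Xn n v ω) ∂(Pn n)) atTop
        (𝓝 (∫ ω, G (fun i => sideValue (b i) (t i) fun v => X v ω) ∂P)))
    (f : E →ᵇ ℝ) (b : Bool) {t : ℝ≥0} (ht : 0 < t) {k : ℕ} {τ : Fin k → ℝ≥0}
    (hτ : ∀ i, 0 < τ i) (h : Fin k → (E →ᵇ ℝ)) :
    Tendsto (fun n => ∫ ω, f (sideValue b t fun v => Xn n v ω) * ∏ i, h i (Xn n (τ i) ω) ∂(Pn n))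
      atTop (𝓝 (∫ ω, f (sideValue b t fun v => X v ω) * ∏ i, h i (X (τ i) ω) ∂P)) := by
  set G : (Fin (k + 1) → E) →ᵇ ℝ := f.compContinuous ⟨fun x => x 0, continuous_apply 0⟩ *
    ∏ i, (h i).compContinuous ⟨fun x => x i.succ, continuous_apply i.succ⟩ with hG
  have := hside (k + 1) (Fin.cons b fun _ => true) (Fin.cons t τ)
    (fun i => by cases i using Fin.cases <;> simp [ht, hτ]) G
  simpa [hG, sideValue] using this

variable [MeasurableSpace E] [BorelSpace E]
  [IsProbabilityMeasure P] [∀ n, IsProbabilityMeasure (Pn n)]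

/-- After Fubini the integrand converges at every `v` in `Ioc s t`, all of which are positive, so
dominated convergence holds for any locally finite `q`, atoms included. -/
theorem tendsto_integral_drift_mul_prod
    (hXcad : ∀ ω, IsCadlag fun t => X t ω) (hXncad : ∀ n ω, IsCadlag fun t => Xn n t ω)
    (hX : ∀ t, Measurable (X t)) (hXn : ∀ n t, Measurable (Xn n t))
    (hside : ∀ (m : ℕ) (b : Fin m → Bool) (t : Fin m → ℝ≥0), (∀ i, 0 < t i) →
      ∀ G : (Fin m → E) →ᵇ ℝ, Tendsto
        (fun n => ∫ ω, G (fun i => sideValue (b i) (t i) fun v => Xn n v ω) ∂(Pn n)) atTop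
        (𝓝 (∫ ω, G (fun i => sideValue (b i) (t i) fun v => X v ω) ∂P)))
    (g : E →ᵇ ℝ) (q : Measure ℝ≥0) [IsLocallyFiniteMeasure q] (s t : ℝ≥0) {k : ℕ}
    {τ : Fin k → ℝ≥0} (hτ : ∀ i, 0 < τ i) (h : Fin k → (E →ᵇ ℝ)) :
    Tendsto (fun n => ∫ ω, (∫ v in Ioc s t, g (Function.leftLim (fun w => Xn n w ω) v) ∂q) *
      ∏ i, h i (Xn n (τ i) ω) ∂(Pn n)) atTop
      (𝓝 (∫ ω, (∫ v in Ioc s t, g (Function.leftLim (fun w => X w ω) v) ∂q) *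
        ∏ i, h i (X (τ i) ω) ∂P)) := by
  have hbd := fun (x : Fin k → E) => abs_prod_boundedContinuousFunction_le h x
  rw [integral_drift_mul hX hXcad g _ (measurable_prod_comp (fun i => hX _) h)
    fun ω => hbd fun i => X (τ i) ω]
  simp_rw [fun n => integral_drift_mul (P := Pn n) (hXn n) (hXncad n) g (q.restrict (Ioc s t))
    (measurable_prod_comp (fun i => hXn n (τ i)) h) fun ω => hbd fun i => Xn n (τ i) ω]
  refine tendsto_integral_of_dominated_convergence (fun _ => ‖g‖ * ∏ i, ‖h i‖)
    (fun n => ?_) (integrable_const _) (fun n => Eventually.of_forall fun v => ?_) ?_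
  · exact (integrable_comp_leftLim_mul (P := Pn n) (hXn n) (hXncad n) g (q.restrict (Ioc s t))
      (measurable_prod_comp (fun i => hXn n (τ i)) h)
      fun ω => hbd fun i => Xn n (τ i) ω).integral_prod_left.aestronglyMeasurable
  · refine (norm_integral_le_of_norm_le_const (C := ‖g‖ * ∏ i, ‖h i‖)
      (Eventually.of_forall fun ω => ?_)).trans (by simp)
    rw [norm_mul]
    exact mul_le_mul (g.norm_coe_le_norm _) (hbd fun i => Xn n (τ i) ω) (norm_nonneg _)
      (norm_nonneg _)
  · filter_upwards [ae_restrict_mem measurableSet_Ioc] with v hv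
    exact tendsto_integral_sideValue_mul_prod hside g false (zero_le.trans_lt hv.1) hτ h

end Limit

/-! ### From a dense set of times to all times -/

section RightLimits

variable {E : Type*} [MetricSpace E] {Ω : Type*} {X : ℝ≥0 → Ω → E}

/-- When both endpoints are approached strictly from the right, the indicators of the half-open
intervals converge at every point, including `s` and `t`, so atoms there do no harm. -/
theorem tendsto_setIntegral_Ioc_right {q : Measure ℝ≥0} [IsLocallyFiniteMeasure q] {γ : ℝ≥0 → ℝ}
    (hγ : Measurable γ) {C : ℝ} (hC : ∀ v, |γ v| ≤ C) {s t : ℝ≥0} {u w : ℕ → ℝ≥0}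
    (hu : Tendsto u atTop (𝓝[>] s)) (hw : Tendsto w atTop (𝓝[>] t)) :
    Tendsto (fun n => ∫ v in Ioc (u n) (w n), γ v ∂q) atTop (𝓝 (∫ v in Ioc s t, γ v ∂q)) := by
  simp_rw [← integral_indicator measurableSet_Ioc]
  have hw1 : ∀ᶠ n in atTop, w n ≤ t + 1 := (tendsto_nhdsWithin_iff.1 hw).1.eventually_le_const
    (lt_add_one t)
  refine tendsto_integral_filter_of_dominated_convergence
    ((Ioc 0 (t + 1)).indicator fun _ => C)
    (Eventually.of_forall fun n => (hγ.indicator measurableSet_Ioc).aestronglyMeasurable) ?_ ?_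
    (Eventually.of_forall fun v => ?_)
  · filter_upwards [hw1] with n hn
    refine Eventually.of_forall fun v => ?_
    by_cases hv : v ∈ Ioc (u n) (w n)
    · rw [indicator_of_mem hv, indicator_of_mem (mem_Ioc.2 ⟨zero_le.trans_lt hv.1, hv.2.trans hn⟩)]
      exact hC v
    · rw [indicator_of_notMem hv, norm_zero]
      exact indicator_nonneg (fun _ _ => (abs_nonneg _).trans (hC v)) v
  · rw [integrable_indicator_iff measurableSet_Ioc]
    exact integrable_const C
  · have h1 := tendsto_nhdsWithin_iff.1 hu
    have h2 := tendsto_nhdsWithin_iff.1 hw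
    refine tendsto_const_nhds.congr' ?_
    rcases le_or_gt v s with hvs | hvs
    · filter_upwards [h1.2] with n hn
      rw [indicator_of_notMem fun h => h.1.not_ge hvs,
        indicator_of_notMem fun h => h.1.not_ge (hvs.trans (le_of_lt hn))]
    rcases le_or_gt v t with hvt | hvt
    · filter_upwards [h1.1.eventually (gt_mem_nhds hvs), h2.2] with n hn hn2
      rw [indicator_of_mem (mem_Ioc.2 ⟨hvs, hvt⟩),
        indicator_of_mem (mem_Ioc.2 ⟨hn, hvt.trans (le_of_lt hn2)⟩)]
    · filter_upwards [h2.1.eventually (gt_mem_nhds hvt)] with n hn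
      rw [indicator_of_notMem fun h => h.2.not_gt hvt, indicator_of_notMem fun h => h.2.not_gt hn]

theorem abs_test_increment_le (f g : E →ᵇ ℝ) (q : Measure ℝ≥0) [IsLocallyFiniteMeasure q]
    (s t : ℝ≥0) (ω : Ω) :
    |f (X t ω) - f (X s ω) - ∫ v in Ioc s t, g (Function.leftLim (fun w => X w ω) v) ∂q| ≤
      2 * ‖f‖ + ‖g‖ * q.real (Ioc 0 t) := by
  have h1 := f.norm_coe_le_norm (X t ω)
  have h2 := f.norm_coe_le_norm (X s ω)
  have h3 : |∫ v in Ioc s t, g (Function.leftLim (fun w => X w ω) v) ∂q| ≤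
      ‖g‖ * q.real (Ioc s t) :=
    norm_setIntegral_le_of_norm_le_const measure_Ioc_lt_top fun v _ => g.norm_coe_le_norm _
  have h4 : q.real (Ioc s t) ≤ q.real (Ioc 0 t) :=
    measureReal_mono (Ioc_subset_Ioc_left zero_le) measure_Ioc_lt_top.ne
  have h5 := mul_le_mul_of_nonneg_left h4 (norm_nonneg g)
  rw [Real.norm_eq_abs] at h1 h2
  rw [abs_le] at *
  constructor <;> linarith [h1.1, h1.2, h2.1, h2.2, h3.1, h3.2]

variable [MeasurableSpace E] [BorelSpace E] [MeasurableSpace Ω] {P : Measure Ω}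
  [IsProbabilityMeasure P]

/-- Orthogonality relations at times in a dense set extend to all times by right-continuity. -/
theorem integral_test_increment_mul_prod_eq_zero_of_dense (hX : ∀ t, Measurable (X t))
    (hc : ∀ ω, IsCadlag fun t => X t ω) (f g : E →ᵇ ℝ) (q : Measure ℝ≥0)
    [IsLocallyFiniteMeasure q] {Γ : Set ℝ≥0} (hΓ : Dense Γ) {k : ℕ} (h : Fin k → (E →ᵇ ℝ))
    (hΓ0 : ∀ s ∈ Γ, ∀ t ∈ Γ, s < t → ∀ τ : Fin k → ℝ≥0, (∀ i, τ i ∈ Γ ∧ 0 < τ i ∧ τ i ≤ s) →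
      0 < s → ∫ ω, (f (X t ω) - f (X s ω) -
        ∫ v in Ioc s t, g (Function.leftLim (fun w => X w ω) v) ∂q) *
          ∏ i, h i (X (τ i) ω) ∂P = 0)
    {s t : ℝ≥0} (hst : s < t) {τ : Fin k → ℝ≥0} (hτ : ∀ i, τ i ≤ s) :
    ∫ ω, (f (X t ω) - f (X s ω) -
        ∫ v in Ioc s t, g (Function.leftLim (fun w => X w ω) v) ∂q) *
          ∏ i, h i (X (τ i) ω) ∂P = 0 := by
  have hd : ∀ m : ℕ, (0 : ℝ≥0) < 1 / ((m : ℝ≥0) + 1) := fun m => by positivity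
  have hs : ∀ m : ℕ, ∃ c ∈ Γ, c ∈ Ioo s (min (s + 1 / ((m : ℝ≥0) + 1)) t) := fun m =>
    hΓ.exists_between (lt_min (lt_add_of_pos_right s (hd m)) hst)
  choose u huΓ hu using hs
  have ht : ∀ m : ℕ, ∃ c ∈ Γ, c ∈ Ioo t (t + 1 / ((m : ℝ≥0) + 1)) := fun m =>
    hΓ.exists_between (lt_add_of_pos_right t (hd m))
  choose w hwΓ hw using ht
  -- The sample times also move strictly right, which makes them positive, but they stay below `u m`
  -- so that they remain in the past of the increment.
  have hτ' : ∀ (m : ℕ) i, ∃ c ∈ Γ, c ∈ Ioo (τ i) (min (τ i + 1 / ((m : ℝ≥0) + 1)) (u m)) :=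
    fun m i => hΓ.exists_between
      (lt_min (lt_add_of_pos_right _ (hd m)) ((hτ i).trans_lt (hu m).1))
  choose σ hσΓ hσ using hτ'
  have hlim : ∀ {r : ℝ≥0} {v : ℕ → ℝ≥0}, (∀ m : ℕ, r < v m ∧ v m < r + 1 / ((m : ℝ≥0) + 1)) →
      Tendsto v atTop (𝓝[>] r) := by
    intro r v hv
    refine tendsto_nhdsWithin_iff.2 ⟨?_, Eventually.of_forall fun m => (hv m).1⟩
    refine tendsto_of_tendsto_of_tendsto_of_le_of_le tendsto_const_nhds ?_
      (fun m => (hv m).1.le) (fun m => (hv m).2.le)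
    simpa using (tendsto_const_nhds (x := r)).add
      (tendsto_one_div_add_atTop_nhds_zero_nat (𝕜 := ℝ≥0))
  have hul := hlim fun m => ⟨(hu m).1, (hu m).2.trans_le (min_le_left _ _)⟩
  have hwl := hlim fun m => ⟨(hw m).1, (hw m).2⟩
  have hσl := fun i => hlim fun m => ⟨(hσ m i).1, (hσ m i).2.trans_le (min_le_left _ _)⟩
  have hw1 : ∀ m, w m ≤ t + 1 := fun m => (hw m).2.le.trans (by
    gcongr
    rw [div_le_one (by positivity)]
    exact le_add_self)
  have hzero := fun m => hΓ0 (u m) (huΓ m) (w m) (hwΓ m)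
    (((hu m).2.trans_le (min_le_right _ _)).trans (hw m).1) (σ m)
    (fun i => ⟨hσΓ m i, zero_le.trans_lt (hσ m i).1,
      ((hσ m i).2.trans_le (min_le_right _ _)).le⟩) (zero_le.trans_lt (hu m).1)
  refine tendsto_nhds_unique (tendsto_integral_of_dominated_convergence
    (fun _ => (2 * ‖f‖ + ‖g‖ * q.real (Ioc 0 (t + 1))) * ∏ i, ‖h i‖)
    (fun m => ?_) (integrable_const _) (fun m => Eventually.of_forall fun ω => ?_)
    (Eventually.of_forall fun ω => ?_)) (tendsto_const_nhds.congr fun m => (hzero m).symm)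
  · have hf : ∀ r, Measurable fun ω => f (X r ω) := fun r => f.continuous.measurable.comp (hX r)
    exact ((((hf _).sub (hf _)).aestronglyMeasurable).sub
      (integrable_drift hX hc g _).aestronglyMeasurable).mul
        (Finset.measurable_fun_prod _ fun i _ =>
          (h i).continuous.measurable.comp (hX _)).aestronglyMeasurable
  · rw [norm_mul]
    refine mul_le_mul ((abs_test_increment_le f g q _ _ ω).trans ?_)
      (abs_prod_boundedContinuousFunction_le h fun i => X (σ m i) ω) (norm_nonneg _)
      (by positivity)
    gcongr
    · exact measure_Ioc_lt_top.ne
    · exact hw1 m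
  · refine Tendsto.mul (Tendsto.sub (Tendsto.sub ?_ ?_) ?_) (tendsto_finsetProd _ fun i _ => ?_)
    · exact (f.continuous.tendsto _).comp (((hc ω).tendsto_right t).comp hwl)
    · exact (f.continuous.tendsto _).comp (((hc ω).tendsto_right s).comp hul)
    · exact tendsto_setIntegral_Ioc_right ((measurable_comp_uncurry_leftLim hX hc g).comp
        measurable_prodMk_right) (fun v => g.norm_coe_le_norm _) hul hwl
    · exact ((h i).continuous.tendsto _).comp (((hc ω).tendsto_right (τ i)).comp (hσl i))

end RightLimits

/-! ### The martingale property for the natural filtration -/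

section NaturalFiltration

variable {E : Type*} [MetricSpace E]

theorem IsCadlag.stopped {ω : ℝ≥0 → E} (h : IsCadlag ω) (t : ℝ≥0) :
    IsCadlag fun v => ω (min v t) := by
  intro v
  constructor
  · have hmin : Continuous fun w : ℝ≥0 => min w t := continuous_id.min continuous_const
    exact (h (min v t)).1.comp (f := fun w => min w t) (s := Ici v) hmin.continuousWithinAt
      fun w hw => min_le_min_right t hw
  · rcases le_or_gt v t with hvt | hvt
    · refine ⟨_, (h.tendsto_leftLim v).congr' ?_⟩
      filter_upwards [self_mem_nhdsWithin] with w hw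
      rw [min_eq_left ((le_of_lt hw).trans hvt)]
    · refine ⟨ω t, tendsto_const_nhds.congr' ?_⟩
      filter_upwards [mem_nhdsWithin_of_mem_nhds (lt_mem_nhds hvt)] with w hw
      rw [min_eq_right (le_of_lt hw)]

theorem IsCadlag.leftLim_stopped {ω : ℝ≥0 → E} (h : IsCadlag ω) {v t : ℝ≥0} (hv : 0 < v)
    (hvt : v ≤ t) : Function.leftLim (fun w => ω (min w t)) v = Function.leftLim ω v := by
  have : (𝓝[<] v).NeBot := nhdsLT_neBot_of_exists_lt ⟨0, hv⟩
  refine leftLim_eq_of_tendsto ((h.tendsto_leftLim v).congr' ?_)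
  filter_upwards [self_mem_nhdsWithin] with w hw
  rw [min_eq_left ((le_of_lt hw).trans hvt)]

variable [MeasurableSpace E] [BorelSpace E] {Ω : Type*} {mΩ : MeasurableSpace Ω} {X : ℝ≥0 → Ω → E}

/-- The drift up to `t` depends only on the path stopped at `t`, which is a càdlàg process
measurable with respect to the σ-field at time `t`. -/
theorem stronglyAdapted_testProcess (hX : ∀ t, StronglyMeasurable (X t))
    (hc : ∀ ω, IsCadlag fun t => X t ω) (q : Measure ℝ≥0) [IsLocallyFiniteMeasure q]
    (f g : E →ᵇ ℝ) : StronglyAdapted (Filtration.natural X hX) (testProcess X q f g) := by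
  intro t
  set 𝓕 := Filtration.natural X hX
  have hm : ∀ s ≤ t, StronglyMeasurable[𝓕 t] (X s) := fun s hs =>
    (Filtration.stronglyAdapted_natural hX s).mono (𝓕.mono hs)
  have h1 : StronglyMeasurable[𝓕 t] fun ω =>
      ∫ v in Ioc 0 t, g (Function.leftLim (fun w => X (min w t) ω) v) ∂q :=
    stronglyMeasurable_drift (mΩ := 𝓕 t) (X := fun v => X (min v t))
      (fun v => (hm _ (min_le_right v t)).measurable) (fun ω => (hc ω).stopped t) g _
  have h2 : (fun ω => ∫ v in Ioc 0 t, g (Function.leftLim (fun w => X (min w t) ω) v) ∂q) =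
      fun ω => ∫ v in Ioc 0 t, g (Function.leftLim (fun w => X w ω) v) ∂q := by
    ext ω
    refine setIntegral_congr_fun measurableSet_Ioc fun v hv => ?_
    simp only [(hc ω).leftLim_stopped hv.1 hv.2]
  rw [h2] at h1
  exact ((f.continuous.comp_stronglyMeasurable (hm t le_rfl)).sub
    (f.continuous.comp_stronglyMeasurable (hm 0 zero_le))).sub h1

theorem testProcess_sub (hX : ∀ t, Measurable (X t)) (hc : ∀ ω, IsCadlag fun t => X t ω)
    (q : Measure ℝ≥0) [IsLocallyFiniteMeasure q] (f g : E →ᵇ ℝ) {s t : ℝ≥0} (hst : s ≤ t) (ω : Ω) :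
    testProcess X q f g t ω - testProcess X q f g s ω = f (X t ω) - f (X s ω) -
      ∫ v in Ioc s t, g (Function.leftLim (fun w => X w ω) v) ∂q := by
  have h1 : ∫ v in Ioc 0 t, g (Function.leftLim (fun w => X w ω) v) ∂q =
      ∫ v in Ioc 0 s, g (Function.leftLim (fun w => X w ω) v) ∂q +
        ∫ v in Ioc s t, g (Function.leftLim (fun w => X w ω) v) ∂q := by
    rw [← setIntegral_union (Ioc_disjoint_Ioc_of_le le_rfl) measurableSet_Ioc
      (integrable_comp_leftLim_path hX hc g _ ω) (integrable_comp_leftLim_path hX hc g _ ω),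
      Ioc_union_Ioc_eq_Ioc zero_le hst]
  simp only [testProcess, h1]
  ring

theorem integrable_testProcess {P : Measure Ω} [IsFiniteMeasure P] (hX : ∀ t, Measurable (X t))
    (hc : ∀ ω, IsCadlag fun t => X t ω) (q : Measure ℝ≥0) [IsLocallyFiniteMeasure q]
    (f g : E →ᵇ ℝ) (t : ℝ≥0) : Integrable (testProcess X q f g t) P := by
  have hf : ∀ u, Integrable (fun ω => f (X u ω)) P := fun u =>
    Integrable.of_bound (f.continuous.measurable.comp (hX u)).aestronglyMeasurable ‖f‖
      (Eventually.of_forall fun _ => f.norm_coe_le_norm _)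
  exact ((hf t).sub (hf 0)).sub (integrable_drift hX hc g _)

/-- A bounded variable that is orthogonal to all products `∏ h_i(Y_i)` of bounded continuous
functions of finitely many `Y_i` has zero integral over each event in `σ(Y_i : i)`. -/
theorem setIntegral_eq_zero_of_forall_prod {P : Measure Ω} [IsProbabilityMeasure P] {I : Type*}
    {Y : I → Ω → E} (hY : ∀ i, Measurable (Y i)) {Z : Ω → ℝ} (hZ : Measurable Z) {c : ℝ}
    (hc : ∀ ω, |Z ω| ≤ c)
    (horth : ∀ (J : Finset I) (h : J → (E →ᵇ ℝ)), ∫ ω, Z ω * ∏ j, h j (Y j ω) ∂P = 0)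
    {B : Set (I → E)} (hB : MeasurableSet B) : ∫ ω in {ω | (fun i => Y i ω) ∈ B}, Z ω ∂P = 0 := by
  have hYm : Measurable fun ω i => Y i ω := measurable_pi_lambda _ hY
  have hZi : Integrable Z P := Integrable.of_bound hZ.aestronglyMeasurable c (Eventually.of_forall hc)
  -- Shifting `Z` by its bound `c` turns orthogonality into equality of the finite-dimensional
  -- marginals of two finite measures, with densities `Z + c` and `c`.
  set d₁ : Ω → ℝ≥0 := fun ω => (Z ω + c).toNNReal with hd₁
  set d₂ : Ω → ℝ≥0 := fun _ => c.toNNReal with hd₂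
  have hd₁m : Measurable d₁ := (hZ.add_const c).real_toNNReal
  have hd₂m : Measurable d₂ := measurable_const
  have hc0 : 0 ≤ c := (abs_nonneg _).trans (hc P.nonempty_of_neZero.some)
  have hd₁r : ∀ ω, (d₁ ω : ℝ) = Z ω + c := fun ω =>
    Real.coe_toNNReal _ (by linarith [(abs_le.1 (hc ω)).1])
  have hd₂r : ∀ ω, (d₂ ω : ℝ) = c := fun ω => Real.coe_toNNReal _ hc0
  set μ₁ := P.withDensity fun ω => (d₁ ω : ℝ≥0∞) with hμ₁
  set μ₂ := P.withDensity fun ω => (d₂ ω : ℝ≥0∞) with hμ₂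
  have hfin₁ : IsFiniteMeasure μ₁ := isFiniteMeasure_withDensity_ofReal (hZi.add (integrable_const c)).2
  have hfin₂ : IsFiniteMeasure μ₂ := isFiniteMeasure_withDensity_ofReal (integrable_const c).2
  have hmarg : ∀ J : Finset I, μ₁.map (fun ω => J.restrict fun i => Y i ω) =
      μ₂.map (fun ω => J.restrict fun i => Y i ω) := by
    intro J
    have hJm : Measurable fun ω => J.restrict fun i => Y i ω :=
      measurable_pi_lambda _ fun i => hY i
    -- The `Unit` factor is a dummy: the uniqueness criterion applied next is stated for a product
    -- with one further space.
    have hJm' : Measurable fun ω => ((J.restrict fun i => Y i ω), ()) := hJm.prodMk measurable_const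
    have h1 : μ₁.map (fun ω => ((J.restrict fun i => Y i ω), ())) =
        μ₂.map (fun ω => ((J.restrict fun i => Y i ω), ())) := by
      refine Measure.ext_of_integral_prod_mul_boundedContinuousFunction fun h e => ?_
      have hF : Measurable fun p : (J → E) × Unit => (∏ i, h i (p.1 i)) * e p.2 :=
        (Finset.measurable_fun_prod _ fun i _ => (h i).continuous.measurable.comp
          ((measurable_pi_apply i).comp measurable_fst)).mul (e.continuous.measurable.comp measurable_snd)
      rw [integral_map hJm'.aemeasurable hF.aestronglyMeasurable,
        integral_map hJm'.aemeasurable hF.aestronglyMeasurable,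
        integral_withDensity_eq_integral_smul hd₁m, integral_withDensity_eq_integral_smul hd₂m]
      simp only [NNReal.smul_def, hd₁r, hd₂r, smul_eq_mul, Finset.restrict]
      set W : Ω → ℝ := fun ω => (∏ i : J, h i (Y i ω)) * e () with hW
      have hWm : Measurable W := (Finset.measurable_fun_prod _ fun i _ =>
        (h i).continuous.measurable.comp (hY i)).mul_const _
      obtain ⟨C, hC⟩ : ∃ C, ∀ ω, ‖W ω‖ ≤ C := by
        refine ⟨(∏ i, ‖h i‖) * ‖e ()‖, fun ω => ?_⟩
        rw [hW, norm_mul, norm_prod]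
        gcongr with i
        exact (h i).norm_coe_le_norm _
      have hWi : Integrable W P := Integrable.of_bound hWm.aestronglyMeasurable C
        (Eventually.of_forall hC)
      have hZW : Integrable (fun ω => Z ω * W ω) P :=
        hZi.mul_bdd hWm.aestronglyMeasurable (Eventually.of_forall hC)
      have h2 : ∫ ω, Z ω * W ω ∂P = 0 := by
        have h3 : ∀ ω, Z ω * W ω = (Z ω * ∏ i : J, h i (Y i ω)) * e () := fun ω => by
          rw [hW]; ring
        simp_rw [h3]
        rw [integral_mul_const, horth J h, zero_mul]
      calc ∫ ω, (Z ω + c) * W ω ∂P = ∫ ω, (Z ω * W ω + c * W ω) ∂P := by simp_rw [add_mul]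
        _ = ∫ ω, c * W ω ∂P := by rw [integral_add hZW (hWi.const_mul c), h2, zero_add]
    have h4 := congrArg (Measure.map Prod.fst) h1
    rwa [Measure.map_map measurable_fst hJm', Measure.map_map measurable_fst hJm'] at h4
  -- Finite-dimensional marginals determine the law on `I → E` for any index set, by uniqueness of
  -- projective limits.
  have hlaw : μ₁.map (fun ω i => Y i ω) = μ₂.map fun ω i => Y i ω := by
    have h1 := isProjectiveLimit_map (P := μ₁) hYm.aemeasurable
    have h2 := isProjectiveLimit_map (P := μ₂) hYm.aemeasurable
    simp_rw [← hmarg] at h2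
    exact h1.unique h2
  have hBm : MeasurableSet {ω | (fun i => Y i ω) ∈ B} := hYm hB
  have h1 : μ₁ {ω | (fun i => Y i ω) ∈ B} = μ₂ {ω | (fun i => Y i ω) ∈ B} := by
    have := congrArg (fun ν => ν B) hlaw
    simp only [Measure.map_apply hYm hB] at this
    exact this
  have h2 : ∫ ω in {ω | (fun i => Y i ω) ∈ B}, (Z ω + c) ∂P =
      ∫ ω in {ω | (fun i => Y i ω) ∈ B}, c ∂P := by
    have h3 := setIntegral_withDensity_eq_setIntegral_smul hd₁m (fun _ => (1 : ℝ)) hBm (μ := P)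
    have h4 := setIntegral_withDensity_eq_setIntegral_smul hd₂m (fun _ => (1 : ℝ)) hBm (μ := P)
    simp only [NNReal.smul_def, hd₁r, hd₂r, smul_eq_mul, mul_one] at h3 h4
    rw [← h3, ← h4, setIntegral_const, setIntegral_const, Measure.real, Measure.real]
    change (μ₁ _).toReal • _ = (μ₂ _).toReal • _
    rw [h1]
  rw [integral_add hZi.integrableOn (integrable_const c)] at h2
  linarith

theorem martingale_testProcess_of_forall_prod {P : Measure Ω} [IsProbabilityMeasure P]
    (hX : ∀ t, StronglyMeasurable (X t))
    (hc : ∀ ω, IsCadlag fun t => X t ω) (q : Measure ℝ≥0) [IsLocallyFiniteMeasure q]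
    (f g : E →ᵇ ℝ)
    (horth : ∀ (s t : ℝ≥0), s < t → ∀ (k : ℕ) (τ : Fin k → ℝ≥0), (∀ i, τ i ≤ s) →
      ∀ h : Fin k → (E →ᵇ ℝ), ∫ ω, (f (X t ω) - f (X s ω) -
        ∫ v in Ioc s t, g (Function.leftLim (fun w => X w ω) v) ∂q) *
          ∏ i, h i (X (τ i) ω) ∂P = 0) :
    Martingale (testProcess X q f g) (Filtration.natural X hX) P := by
  have hXm : ∀ t, Measurable (X t) := fun t => (hX t).measurable
  have hadapted := stronglyAdapted_testProcess hX hc q f g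
  have hint := fun t => integrable_testProcess (P := P) hXm hc q f g t
  refine ⟨hadapted, fun s t hst => ?_⟩
  set 𝓕 := Filtration.natural X hX with h𝓕
  rcases eq_or_lt_of_le hst with rfl | hst'
  · rw [condExp_of_stronglyMeasurable (𝓕.le s) (hadapted s) (hint s)]
  refine (ae_eq_condExp_of_forall_setIntegral_eq (𝓕.le s) (hint t)
    (fun _ _ _ => (hint s).integrableOn) (fun A hA _ => ?_) (hadapted s).aestronglyMeasurable).symm
  rw [h𝓕, Filtration.natural_eq_comap] at hA
  obtain ⟨B, hB, rfl⟩ := hA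
  have hbd : ∀ ω, |(testProcess X q f g t - testProcess X q f g s) ω| ≤
      2 * ‖f‖ + ‖g‖ * q.real (Ioc 0 t) := fun ω => by
    rw [Pi.sub_apply, testProcess_sub hXm hc q f g hst]
    exact abs_test_increment_le f g q s t ω
  have hm : ∀ t, Measurable (testProcess X q f g t) := fun t =>
    ((hadapted t).mono (𝓕.le t)).measurable
  have h1 := setIntegral_eq_zero_of_forall_prod (P := P) (I := Iic s) (Y := fun i => X i)
    (fun i => hXm i) ((hm t).sub (hm s)) hbd (fun J h => ?_) hB
  · have h2 : ∫ ω in {ω | (fun i : Iic s => X i ω) ∈ B},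
        (testProcess X q f g t ω - testProcess X q f g s ω) ∂P = 0 := h1
    rw [integral_sub (hint t).integrableOn (hint s).integrableOn, sub_eq_zero] at h2
    exact h2.symm
  · have h3 := horth s t hst' _ (fun i => ((Finset.equivFin J).symm i).1.1)
      (fun i => ((Finset.equivFin J).symm i).1.2) (fun i => h ((Finset.equivFin J).symm i))
    rw [← h3]
    refine integral_congr_ae (Eventually.of_forall fun ω => ?_)
    simp only [Pi.sub_apply]
    rw [testProcess_sub hXm hc q f g hst,
      ← Equiv.prod_comp (Finset.equivFin J).symm fun j => h j (X j ω)]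

end NaturalFiltration

theorem integral_test_increment_mul {E : Type*} [MetricSpace E] [MeasurableSpace E] [BorelSpace E]
    {Ω : Type*} {mΩ : MeasurableSpace Ω} {P : Measure Ω} [IsFiniteMeasure P] {X : ℝ≥0 → Ω → E}
    (hX : ∀ t, Measurable (X t)) (hc : ∀ ω, IsCadlag fun t => X t ω) (f g : E →ᵇ ℝ)
    (q : Measure ℝ≥0) [IsLocallyFiniteMeasure q] (s t : ℝ≥0) {H : Ω → ℝ} (hH : Measurable H)
    {C : ℝ} (hC : ∀ ω, |H ω| ≤ C) :
    ∫ ω, (f (X t ω) - f (X s ω) -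
        ∫ v in Ioc s t, g (Function.leftLim (fun w => X w ω) v) ∂q) * H ω ∂P =
      ∫ ω, f (X t ω) * H ω ∂P - ∫ ω, f (X s ω) * H ω ∂P -
        ∫ ω, (∫ v in Ioc s t, g (Function.leftLim (fun w => X w ω) v) ∂q) * H ω ∂P := by
  have hmul : ∀ {Y : Ω → ℝ}, Integrable Y P → Integrable (fun ω => Y ω * H ω) P := fun hY =>
    hY.mul_bdd hH.aestronglyMeasurable (Eventually.of_forall hC)
  have hf : ∀ u, Integrable (fun ω => f (X u ω)) P := fun u =>
    Integrable.of_bound (f.continuous.measurable.comp (hX u)).aestronglyMeasurable ‖f‖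
      (Eventually.of_forall fun _ => f.norm_coe_le_norm _)
  have hfH : Integrable (fun ω => f (X t ω) * H ω - f (X s ω) * H ω) P :=
    (hmul (hf t)).sub (hmul (hf s))
  simp_rw [sub_mul]
  rw [integral_sub hfH (hmul (integrable_drift hX hc g _)), integral_sub (hmul (hf t)) (hmul (hf s))]

/-! ### Passage to the limit in the martingale identity -/

theorem theorem4p3
    -- the Polish state space `(E, r)`
    {E : Type*} [MetricSpace E] [CompleteSpace E] [SecondCountableTopology E]
    [MeasurableSpace E] [BorelSpace E]
    -- the limit process `X`; its filtration is the one generated by `X`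
    {Ω : Type*} [MeasurableSpace Ω] (P : Measure Ω) [IsProbabilityMeasure P]
    (X : ℝ≥0 → Ω → E) (hXmeas : ∀ t, StronglyMeasurable (X t))
    (hXcad : ∀ ω, IsCadlag (fun t => X t ω))
    -- the approximating processes `Xⁿ`
    {Ωn : ℕ → Type*} [mΩn : ∀ n, MeasurableSpace (Ωn n)] (Pn : ∀ n, Measure (Ωn n))
    [∀ n, IsProbabilityMeasure (Pn n)] (𝓕n : ∀ n, Filtration ℝ≥0 (mΩn n))
    (Xn : ∀ n, ℝ≥0 → Ωn n → E) (hXnad : ∀ n, StronglyAdapted (𝓕n n) (Xn n))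
    (hXncad : ∀ n ω, IsCadlag (fun t => Xn n t ω))
    -- the set of pairs `(f, g)` and the locally finite measures `q, q¹, q², …`
    (D : Set ((E →ᵇ ℝ) × (E →ᵇ ℝ)))
    (q : Measure ℝ≥0) [IsLocallyFiniteMeasure q]
    (qn : ℕ → Measure ℝ≥0) [∀ n, IsLocallyFiniteMeasure (qn n)]
    -- the sets `𝔛ⁿ`
    (𝔛n : ∀ n, Set ((ℝ≥0 → Ωn n → ℝ) × (ℝ≥0 → Ωn n → ℝ)))
    (h𝔛n : ∀ n, ∀ p ∈ 𝔛n n, IsApproximatingPair (𝓕n n) (Pn n) (qn n) p.1 p.2)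
    -- the data of the set `A`
    {U : Type*} [MeasurableSpace U]
    (𝔲 : U → ℝ≥0 → ℝ≥0) (h𝔲 : Measurable (Function.uncurry 𝔲))
    (h𝔲lim : ∀ (u : U) (t : ℝ≥0), 0 < t →
      Tendsto (fun ε : ℝ => ⨆ s ∈ {s : ℝ≥0 | s ≠ t ∧ (t : ℝ) - ε ≤ s ∧ (s : ℝ) ≤ t + ε},
        (𝔲 u s : ℝ≥0∞)) (𝓝[>] 0) (𝓝 0))
    (κ : ℝ≥0 → ℝ≥0) (hκmono : Monotone κ) (hκcont : Continuous κ) (x₀ : E)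
    -- weak convergence `Xⁿ → X` in `𝔻(E)` with the Skorokhod `J₁` topology
    (hconv : TendstoInDistribution (fun n => pathMap (Xn n) (hXncad n)) atTop
      (pathMap X hXcad) Pn P)
    -- the control variables `Lⁿ`
    (L : ∀ n, Ωn n → U) (hL : ∀ n, Measurable (L n))
    (hA : Tendsto (fun n => Pn n {ω | (L n ω, pathMap (Xn n) (hXncad n) ω) ∈
      jumpControlSet 𝔲 κ x₀}) atTop (𝓝 1))
    (hLlaw : (∀ n, (Pn n).map (L n) = (Pn 0).map (L 0)) ∨
      (MeasurableSpace.CountablyGenerated U ∧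
        IsRelativelyCompactInMm {ν : ProbabilityMeasure U | ∃ n, (ν : Measure U) =
          (Pn n).map (L n)}))
    -- the approximation conditions
    (Γ : Set ℝ≥0) (hΓ : Dense Γ)
    (happrox : ∀ p ∈ D, ∀ T : ℝ≥0, 0 < T →
      ∃ (ξ φ : ∀ n, ℝ≥0 → Ωn n → ℝ), (∀ n, (ξ n, φ n) ∈ 𝔛n n) ∧
        (⨆ n, ⨆ s ≤ T, ∫⁻ ω, (‖ξ n s ω‖ₑ + ‖φ n s ω‖ₑ) ∂(Pn n)) < ∞ ∧
        ∀ s ∈ Γ, ∀ t ∈ Γ, s < t → t ≤ T →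
        ∀ (k : ℕ) (τ : Fin k → ℝ≥0), (∀ i, τ i ∈ Γ ∧ τ i ≤ t) → ∀ h : Fin k → (E →ᵇ ℝ),
          Tendsto (fun n => ∫ ω, (ξ n t ω - p.1 (Xn n t ω)) *
            ∏ i, h i (Xn n (τ i) ω) ∂(Pn n)) atTop (𝓝 0) ∧
          Tendsto (fun n => ∫ ω, (∫ v in Ioc s t,
              (φ n v ω - p.2 (Function.leftLim (fun w => Xn n w ω) v)) ∂q) *
            ∏ i, h i (Xn n (τ i) ω) ∂(Pn n)) atTop (𝓝 0) ∧
          Tendsto (fun n => ∫ ω, ((∫ v in Ioc s t, φ n v ω ∂(qn n)) -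
              ∫ v in Ioc s t, φ n v ω ∂q) *
            ∏ i, h i (Xn n (τ i) ω) ∂(Pn n)) atTop (𝓝 0)) :
    SolvesMartingaleProblem (Filtration.natural X hXmeas) P (testProcesses X q D) := by
  rintro _ ⟨⟨f, g⟩, hfg, rfl⟩
  have hX : ∀ t, Measurable (X t) := fun t => (hXmeas t).measurable
  have hXn : ∀ n t, Measurable (Xn n t) := fun n t =>
    ((hXnad n t).mono ((𝓕n n).le t)).measurable
  have hosc : ∀ t a : ℝ≥0, 0 < t → 0 < a → ∀ ε : ℝ≥0∞, 0 < ε → ∃ δ : ℝ, 0 < δ ∧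
      ∀ᶠ n in atTop, Pn n {ω | pathMap (Xn n) (hXncad n) ω ∉
        SkorokhodSpace.smallOsc E t a δ} ≤ ε := fun t a ht ha _ hε =>
    exists_eventually_measure_notMem_smallOsc_le hconv ht ha
      (fun _ hε' => exists_eventually_measure_jump_le hXcad hXn hXncad h𝔲 h𝔲lim hκmono hκcont
        hconv hL hA (hLlaw.imp_right And.right) ht ha hε') hε
  have hside : ∀ (m : ℕ) (b : Fin m → Bool) (t : Fin m → ℝ≥0), (∀ i, 0 < t i) →
      ∀ G : (Fin m → E) →ᵇ ℝ, Tendsto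
        (fun n => ∫ ω, G (fun i => sideValue (b i) (t i) fun v => Xn n v ω) ∂(Pn n)) atTop
        (𝓝 (∫ ω, G (fun i => sideValue (b i) (t i) fun v => X v ω) ∂P)) := fun m b t ht G =>
    tendsto_integral_sideValue hconv hX hXn hosc b ht G
  refine martingale_testProcess_of_forall_prod hXmeas hXcad q f g fun s t hst k τ hτ h =>
    integral_test_increment_mul_prod_eq_zero_of_dense hX hXcad f g q hΓ h ?_ hst hτ
  clear hτ τ hst t s
  intro s hsΓ t htΓ hst τ hτ hs0
  have hτ0 : ∀ i, 0 < τ i := fun i => (hτ i).2.1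
  have hbd := fun (x : Fin k → E) => abs_prod_boundedContinuousFunction_le h x
  obtain ⟨ξ, φ, hξφ, -, happ⟩ := happrox (f, g) hfg t (hs0.trans hst)
  have hpair := fun n => h𝔛n n _ (hξφ n)
  -- The convergence of `ξ - f (X)` is available at the right endpoint of an interval only, so an
  -- auxiliary interval `(r, s]` is needed to obtain it at `s`.
  obtain ⟨r, hrΓ, -, hrs⟩ := hΓ.exists_between hs0
  obtain ⟨h1, h2, h3⟩ := happ s hsΓ t htΓ hst le_rfl k τ
    (fun i => ⟨(hτ i).1, (hτ i).2.2.trans hst.le⟩) h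
  obtain ⟨h4, -, -⟩ := happ r hrΓ s hsΓ hrs hst.le k τ (fun i => ⟨(hτ i).1, (hτ i).2.2⟩) h
  have hlim0 := ((h4.sub h1).add h3).add h2
  simp only [sub_zero, add_zero] at hlim0
  have hH : ∀ n, StronglyMeasurable[𝓕n n s] fun ω => ∏ i, h i (Xn n (τ i) ω) := fun n =>
    (measurable_prod_comp (m := 𝓕n n s) (fun i =>
      ((hXnad n (τ i)).mono ((𝓕n n).mono (hτ i).2.2)).measurable) h).stronglyMeasurable
  have hprelim := hlim0.congr fun n => ((hpair n).integral_test_increment_mul_eq (hXn n)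
    (hXncad n) f g q hs0 hst (hH n) fun ω => hbd fun i => Xn n (τ i) ω).symm
  -- The tested increments of `Xⁿ` tend to `0` by the error decomposition and to the tested
  -- increment of `X` by convergence of the joint laws.
  refine tendsto_nhds_unique ?_ hprelim
  rw [integral_test_increment_mul hX hXcad f g q s t (measurable_prod_comp (fun i => hX (τ i)) h)
    fun ω => hbd fun i => X (τ i) ω]
  simp_rw [fun n => integral_test_increment_mul (P := Pn n) (hXn n) (hXncad n) f g q s t
    (measurable_prod_comp (fun i => hXn n (τ i)) h) fun ω => hbd fun i => Xn n (τ i) ω]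
  exact ((tendsto_integral_sideValue_mul_prod hside f true (hs0.trans hst) hτ0 h).sub
    (tendsto_integral_sideValue_mul_prod hside f true hs0 hτ0 h)).sub
    (tendsto_integral_drift_mul_prod hXcad hXncad hX hXn hside g q s t hτ0 h)
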